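/- Conventions. A multivalued map $F\colon X\to Y$ assigns to each $x\in X$ a nonempty subset $F(x)\subset Y$; its graph is $\Gamma_F=\{(x,y)\in X\times Y : y\in F(x)\}$, and $\Gamma_F(K)=\{(x,y)\in\Gamma_F : x\in K\}$ for $K\subset X$. $F$ is called compact if every $F(x)$ is compact and $\{x : F(x)\subset U\}$ is open in $X$ for every open $U\subset Y$. ANR means absolute neighborhood retract for separable metrizable spaces, and $\dim$ is the Lebesgue covering dimension. A fiberwise transformation $T$ from $F\colon X\to Y$ to $G\colon X\to Y'$ is a continuous map $T\colon\Gamma_F\to\Gamma_G$ with $T(\{x\}\times F(x))\subset\{x\}\times G(x)$ for all $x\in X$; it determines continuous maps $T(x)\colon F(x)\to G(x)$. A multivalued map $F\colon X\to Y$ contains (admits) the singular filtration $\{(F_i,T_i)\}_{i=0}^n$, of length $n$, if each $F_i\colon X\to Y_i$ is a multivalued map to a separable metrizable space $Y_i$ and each $T_i$ is a fiberwise transformation from $F_i$ to $F_{i+1}$, where $F_{n+1}=F$. The filtration is compact if the maps $F_0,\dots,F_n$ are compact. Let $\phi\colon K\to K'$ be a continuous map of compact metrizable spaces. The triple $(K,\phi,K')$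 is approximately $m$-aspheric if, for all embeddings $K\subset Z$, $K'\subset Z'$ into ANRs, every continuous extension $\widetilde\phi\colon OK\to Z'$ of $\phi$ to a neighborhood $OK$ of $K$ in $Z$ and every neighborhood $U$ of $K'$ in $Z'$, there is a neighborhood $V\subset OK$ of $K$ such that for every continuous $f\colon S^m\to V$ the map $\widetilde\phi\circ f$ takes values in $U$ and is null-homotopic in $U$. The compactum $K$ is approximately $m$-aspheric if, for every embedding of $K$ into an ANR $Z$ and every neighborhood $U$ of $K$ in $Z$, there is a neighborhood $V$ of $K$ such that every continuous $f\colon S^m\to V$ takes values in $U$ and is null-homotopic in $U$. A compact singular filtration $\{(F_i,T_i)\}_{i=0}^n$ is approximately connected if for every $x\in X$ and every $0\le i<n$ the triple $(F_i(x),T_i(x),F_{i+1}(x))$ is approximately $i$-aspheric; it is approximately $\infty$-connected if, in addition, $F_n(x)$ is approximately $k$-aspheric for all $x\in X$ and all $k\ge n$. Theorem. (1) Let $H\colon X\to Y$ be a multivalued map of a metric space $X$ to a Banach space $Y$. If $\dim X\le n$ and $H$ contains an approximately connected singular filtration $\{(H_i\colon X\to Y_i,T_i)\}_{i=0}^n$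 of compact maps, then every neighborhood of $\Gamma_H$ in $X\times Y$ contains the graph of a continuous single-valued map $h\colon X\to Y$. (2) Let $X$ and $Y$ be separable metrizable ANRs and let $F\colon X\to Y$ be a compact multivalued map that admits a compact approximately $\infty$-connected singular filtration (of some finite length $n\ge 0$). Then for every compact $K\subset X$ every neighborhood of $\Gamma_F(K)$ in $X\times Y$ contains the graph of a continuous single-valued map $f\colon K\to Y$. -/

import Mathlib

open Topology Set

universe u v w

/-- `dim X ≤ n` for the Lebesgue covering dimension: every open cover has an open refinement
such that no point lies in more than `n + 1` members of it. -/
def CoveringDimLE (X : Type u) [TopologicalSpace X] (n : ℕ) : Prop :=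
  ∀ 𝒰 : Set (Set X), (∀ A ∈ 𝒰, IsOpen A) → ⋃₀ 𝒰 = univ →
    ∃ 𝒱 : Set (Set X), (∀ B ∈ 𝒱, IsOpen B) ∧ ⋃₀ 𝒱 = univ ∧ (∀ B ∈ 𝒱, ∃ A ∈ 𝒰, B ⊆ A) ∧
      ∀ x : X, {B ∈ 𝒱 | x ∈ B}.encard ≤ n + 1

/-- Absolute neighborhood retracts in the class of separable metrizable spaces: whenever `Z` is
embedded as a closed subset of a separable metrizable space `W`, it is a retract of an open
neighborhood in `W`. -/
structure IsANR (Z : Type u) [TopologicalSpace Z] : Prop where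
  metrizable : TopologicalSpace.MetrizableSpace Z
  separable : TopologicalSpace.SeparableSpace Z
  retract : ∀ (W : Type u) [TopologicalSpace W] [TopologicalSpace.MetrizableSpace W]
    [TopologicalSpace.SeparableSpace W] (e : Z → W), IsClosedEmbedding e →
      ∃ O : Set W, IsOpen O ∧ range e ⊆ O ∧
        ∃ r : C(O, Z), ∀ (z : Z) (hz : e z ∈ O), r ⟨e z, hz⟩ = z

/-- The standard sphere `S^m`. -/
abbrev StdSphere (m : ℕ) : Type := Metric.sphere (0 : EuclideanSpace ℝ (Fin (m + 1))) 1

/-- The singular pair `(K, φ, K')` is approximately `m`-aspheric: for all embeddings `e`, `e'` of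
`K`, `K'` into ANR-spaces `Z`, `Z'`, every extension `ψ : O → Z'` of `φ` to a neighborhood `O` of
`K` in `Z` and every neighborhood `U` of `K'` in `Z'` there is a neighborhood `V ⊆ O` of `K` such
that for every `f : S^m → V` the composition `ψ ∘ f` maps to `U` and is null-homotopic in `U`. -/
def ApproxAsphericPair (m : ℕ) {K : Type u} {K' : Type v} [TopologicalSpace K]
    [TopologicalSpace K'] (φ : C(K, K')) : Prop :=
  ∀ (Z : Type u) [TopologicalSpace Z] (Z' : Type v) [TopologicalSpace Z'],
    IsANR Z → IsANR Z' →
    ∀ (e : K → Z) (e' : K' → Z'), IsEmbedding e → IsEmbedding e' →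
    ∀ O ∈ 𝓝ˢ (range e), ∀ ψ : C(O, Z'),
      (∀ (k : K) (hk : e k ∈ O), ψ ⟨e k, hk⟩ = e' (φ k)) →
    ∀ U ∈ 𝓝ˢ (range e'), ∃ V ∈ 𝓝ˢ (range e), V ⊆ O ∧
      ∀ f : C(StdSphere m, O), (∀ s, (f s : Z) ∈ V) →
        ∃ g : C(StdSphere m, U), (∀ s, (g s : Z') = ψ (f s)) ∧ g.Nullhomotopic

/-- The compactum `K` is approximately `m`-aspheric: for every embedding `e` of `K` into an
ANR-space `Z`, every neighborhood `U` of `K` in `Z` contains the images of all maps of `S^m` into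
some neighborhood `V` of `K`, and these maps are null-homotopic in `U`. -/
def ApproxAspheric (m : ℕ) (K : Type u) [TopologicalSpace K] : Prop :=
  ∀ (Z : Type u) [TopologicalSpace Z], IsANR Z → ∀ e : K → Z, IsEmbedding e →
    ∀ U ∈ 𝓝ˢ (range e), ∃ V ∈ 𝓝ˢ (range e),
      ∀ f : C(StdSphere m, Z), (∀ s, f s ∈ V) →
        ∃ g : C(StdSphere m, U), (∀ s, (g s : Z) = f s) ∧ g.Nullhomotopic

/-- A multivalued map from `X` to `Y`; point-images are nonempty. -/
structure MultivaluedMap (X : Type u) (Y : Type v) where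
  toFun : X → Set Y
  nonempty_apply : ∀ x, (toFun x).Nonempty

namespace MultivaluedMap

variable {X : Type u} {Y : Type v}

instance : CoeFun (MultivaluedMap X Y) (fun _ => X → Set Y) := ⟨toFun⟩

/-- The part of the graph of `F` over `A`. -/
def graphOn (F : MultivaluedMap X Y) (A : Set X) : Set (X × Y) := {p | p.1 ∈ A ∧ p.2 ∈ F p.1}

/-- The graph of `F`. -/
def graph (F : MultivaluedMap X Y) : Set (X × Y) := {p | p.2 ∈ F p.1}

/-- A compact mapping: upper semicontinuous with compact point-images. -/
structure IsCompactMap [TopologicalSpace X] [TopologicalSpace Y] (F : MultivaluedMap X Y) :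
    Prop where
  upperSemicontinuous : ∀ U : Set Y, IsOpen U → IsOpen {x | F x ⊆ U}
  isCompact_apply : ∀ x, IsCompact (F x)

end MultivaluedMap

/-- A fiberwise transformation from `F` to `G`: a continuous map of graphs over the identity
of `X`. -/
structure FiberwiseTransformation {X : Type u} {Y : Type v} {Y' : Type w} [TopologicalSpace X]
    [TopologicalSpace Y] [TopologicalSpace Y'] (F : MultivaluedMap X Y)
    (G : MultivaluedMap X Y') where
  toMap : C(F.graph, G.graph)
  fst_eq : ∀ p : F.graph, (toMap p : X × Y').1 = (p : X × Y).1

namespace FiberwiseTransformation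

variable {X : Type u} {Y : Type v} {Y' : Type w} [TopologicalSpace X] [TopologicalSpace Y]
  [TopologicalSpace Y'] {F : MultivaluedMap X Y} {G : MultivaluedMap X Y'}

theorem snd_mem (T : FiberwiseTransformation F G) (p : F.graph) :
    (T.toMap p : X × Y').2 ∈ G (p : X × Y).1 := by
  rw [← T.fst_eq p]
  exact (T.toMap p).2

/-- The fiber `T(x) : F(x) → G(x)` over the point `x`. -/
def fiber (T : FiberwiseTransformation F G) (x : X) : C(F x, G x) where
  toFun y := ⟨(T.toMap ⟨(x, y), y.2⟩ : X × Y').2, T.snd_mem ⟨(x, y), y.2⟩⟩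
  continuous_toFun := by fun_prop

end FiberwiseTransformation

/-- A singular filtration `{(F_i : X → Y_i, T_i)}` for `i = 0, …, n` of multivalued maps contained
in `F`: for `i < n` the fiberwise transformation `T_i = trans i` goes from `F_i` to `F_{i+1}`, and
`T_n = transLast` goes from `F_n` to `F`. The `Y_i` are separable metrizable spaces. -/
structure SingularFiltration {X : Type u} {Y : Type v} [TopologicalSpace X] [TopologicalSpace Y]
    (F : MultivaluedMap X Y) (n : ℕ) where
  space : Fin (n + 1) → Type w
  [top : ∀ i, TopologicalSpace (space i)]
  [metrizable : ∀ i, TopologicalSpace.MetrizableSpace (space i)]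
  [separable : ∀ i, TopologicalSpace.SeparableSpace (space i)]
  map : ∀ i, MultivaluedMap X (space i)
  trans : ∀ i : Fin n, FiberwiseTransformation (map i.castSucc) (map i.succ)
  transLast : FiberwiseTransformation (map (Fin.last n)) F

namespace SingularFiltration

attribute [instance] SingularFiltration.top

variable {X : Type u} {Y : Type v} [TopologicalSpace X] [TopologicalSpace Y]
  {F : MultivaluedMap X Y} {n : ℕ}

/-- All members of the filtration are compact mappings. -/
def IsCompactFiltration (ℱ : SingularFiltration.{u, v, w} F n) : Prop :=
  ∀ i, (ℱ.map i).IsCompactMap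

/-- Approximate connectedness: for `i < n` and every point `x`, the singular pair
`(F_i(x), T_i(x), F_{i+1}(x))` is approximately `i`-aspheric. -/
def IsApproxConnected (ℱ : SingularFiltration.{u, v, w} F n) : Prop :=
  ∀ (x : X) (i : Fin n), ApproxAsphericPair (i : ℕ) ((ℱ.trans i).fiber x)

/-- Approximate `∞`-connectedness: moreover, the point-images `F_n(x)` are approximately
`k`-aspheric for all `k ≥ n`. -/
def IsApproxInftyConnected (ℱ : SingularFiltration.{u, v, w} F n) : Prop :=
  ℱ.IsApproxConnected ∧
    ∀ (x : X) (k : ℕ), n ≤ k → ApproxAspheric k (ℱ.map (Fin.last n) x)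

end SingularFiltration

/-! Every target space of the filtration is embedded in `ℕ → ℝ`, which is locally convex and an
absolute extensor. The graph of a compact map is closed, so by Tietze each transformation extends to
a map `T i` on all of `X × (ℕ → ℝ)`, and approximate asphericity becomes a property of open sets of
`ℕ → ℝ` (`AsphericAlong`).

The core is an induction over skeleta, `exists_skeleton_map`. If the `i`-skeleton of the nerve of a
fine cover is mapped near the graph of the `i`-th member, pushing it forward by `T i` puts it near
the graph of the next member, and `i`-asphericity fills the boundaries of the `(i+1)`-simplices. `T
i` depends on the base point, so its values over several base points are averaged; local convexity
makes the average homotopic to the push-forward over one fixed base point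
(`AsphericAlong.exists_uniform`). When `dim X ≤ n` the nerve has no simplices beyond the
`n`-skeleton, and composing with the canonical map to the nerve gives a map whose graph is near that
of `H n` (`exists_graph_approximation`).

It remains to apply the last transformation, extended to a neighborhood of the graph: approximately,
by convexity, for a normed target; exactly for an ANR target. In (2) the compactum may be
infinite-dimensional. It is replaced by a nearby compact set `P` in `ℝ^N` with a map `ρ` to `X`; the
filtration is pulled back along `ρ` and prolonged by identity maps up to the dimension bound of `P`,
which is what `∞`-connectedness allows. -/

/-! ### Spheres and boundaries of simplices -/

/-- A null-homotopic map of the standard sphere extends to the whole Euclidean space. -/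
theorem exists_extension_of_nullhomotopic {m : ℕ} {Z : Type*} [TopologicalSpace Z]
    (f : C(StdSphere m, Z)) (hf : f.Nullhomotopic) :
    ∃ F : C(EuclideanSpace ℝ (Fin (m + 1)), Z), ∀ s : StdSphere m, F s = f s := by
  classical
  obtain ⟨z, ⟨H⟩⟩ := hf
  -- Polar coordinates, with an arbitrary value of `N` at the origin. The time `t` is 0 on the unit
  -- sphere and 1 on the ball of radius 1/2; there the homotopy is constant, so the jump of `N` is
  -- invisible.
  let N : EuclideanSpace ℝ (Fin (m + 1)) → StdSphere m := fun x =>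
    if h : x = 0 then ⟨EuclideanSpace.single 0 1, by simp⟩
    else ⟨‖x‖⁻¹ • x, by simp [norm_smul, h]⟩
  let t : EuclideanSpace ℝ (Fin (m + 1)) → unitInterval := fun x =>
    projIcc 0 1 zero_le_one (2 - 2 * ‖x‖)
  have hNc : ∀ x, x ≠ 0 → ContinuousAt N x := by
    intro x hx
    rw [Topology.IsInducing.subtypeVal.continuousAt_iff]
    have : (fun y : EuclideanSpace ℝ (Fin (m + 1)) => ‖y‖⁻¹ • y) =ᶠ[𝓝 x] Subtype.val ∘ N := by
      filter_upwards [isOpen_ne.mem_nhds hx] with y hy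
      have hy' : y ≠ 0 := hy
      simp [N, hy']
    refine ContinuousAt.congr ?_ this
    exact (continuous_norm.continuousAt.inv₀ (norm_ne_zero_iff.2 hx)).smul continuousAt_id
  have htc : Continuous t := continuous_projIcc.comp (by fun_prop)
  refine ⟨⟨fun x => H (t x, N x), continuous_iff_continuousAt.2 fun x => ?_⟩, fun s => ?_⟩
  · by_cases hx : x = 0
    · subst hx
      have : (fun _ => z) =ᶠ[𝓝 (0 : EuclideanSpace ℝ (Fin (m + 1)))] fun x => H (t x, N x) := by
        filter_upwards [Metric.ball_mem_nhds 0 (by norm_num : (0 : ℝ) < 1 / 2)] with y hy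
        have hy' : ‖y‖ < 1 / 2 := by simpa using hy
        have : t y = 1 := projIcc_of_right_le _ (by linarith)
        rw [this]
        simp
      exact continuousAt_const.congr this
    · exact H.continuous.continuousAt.comp (f := fun x => (t x, N x))
        (htc.continuousAt.prodMk (hNc x hx))
  · have hs : ‖(s : EuclideanSpace ℝ (Fin (m + 1)))‖ = 1 := by simp
    have h0 : (s : EuclideanSpace ℝ (Fin (m + 1))) ≠ 0 := by
      intro h; rw [h] at hs; simp at hs
    have ht : t s = 0 := projIcc_of_le_left _ (by rw [hs]; norm_num)
    have hN : N s = s := by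
      simp only [N, dif_neg h0]
      ext1
      simp [hs]
    simp only [ContinuousMap.coe_mk, ht, hN]
    simp

/-- The closed simplex spanned by the finite set `B` of vertices, in barycentric coordinates. -/
def closedSimplex {ι : Type*} (B : Finset ι) : Set (ι → ℝ) :=
  {s | (∀ v, 0 ≤ s v) ∧ (∀ v ∉ B, s v = 0) ∧ ∑ v ∈ B, s v = 1}

/-- The boundary of a simplex of dimension `m + 1` is parametrized by the sphere `S^m`, and a
left inverse of the parametrization extends continuously to the simplex. -/
theorem exists_sphere_parametrization {ι : Type*} (B : Finset ι) (m : ℕ) (hB : B.card = m + 2) :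
    ∃ (c : C(ι → ℝ, EuclideanSpace ℝ (Fin (m + 1)))) (σ : C(StdSphere m, ι → ℝ)),
      (∀ t, σ t ∈ closedSimplex B ∧ ∃ v ∈ B, σ t v = 0) ∧
      ∀ s ∈ closedSimplex B, (∃ v ∈ B, s v = 0) →
        ∃ h : c s ∈ Metric.sphere (0 : EuclideanSpace ℝ (Fin (m + 1))) 1, σ ⟨c s, h⟩ = s := by
  classical
  let e : Fin (m + 2) ≃ B := (B.equivFinOfCardEq hB).symm
  have hsumB : ∀ s : ι → ℝ, ∑ v ∈ B, s v = ∑ j, s (e j) := fun s => by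
    rw [← Finset.sum_coe_sort, ← e.sum_comp]
  set M : ℝ := (m : ℝ) + 2 with hM
  have hMpos : 0 < M := by positivity
  -- Sphere and boundary are matched by central projection from the barycenter, all of whose
  -- coordinates are `1 / M`; `u` identifies `ℝ^(m+1)` with the vectors of coordinate sum 0.
  let u : EuclideanSpace ℝ (Fin (m + 1)) → Fin (m + 2) → ℝ := fun w =>
    Fin.cons (-∑ j, w j) (fun j => w j)
  have hu0 : ∀ w, u w 0 = -∑ j, w j := fun w => rfl
  have hus : ∀ w j, u w (Fin.succ j) = w j := fun w j => rfl
  have huc : ∀ j, Continuous fun w => u w j := by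
    intro j
    refine Fin.cases ?_ (fun j => ?_) j
    · simp only [hu0]; fun_prop
    · simp only [hus]; fun_prop
  have husum : ∀ w, ∑ j, u w j = 0 := fun w => by
    rw [Fin.sum_univ_succ]; simp [hu0, hus]
  have hsmul : ∀ (a : ℝ) w j, u (a • w) j = a * u w j := by
    intro a w j
    refine Fin.cases ?_ (fun j => ?_) j
    · simp [hu0, Finset.mul_sum]
    · simp [hus]
  -- A gauge of the simplex: barycenter plus `u w` lies in it iff `g w ≤ 1 / M`, and on its boundary
  -- iff equality holds.
  let g : EuclideanSpace ℝ (Fin (m + 1)) → ℝ := fun w =>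
    Finset.univ.sup' ⟨0, Finset.mem_univ _⟩ (fun j => -u w j)
  have hgc : Continuous g :=
    Continuous.finset_sup'_apply _ fun j _ => (huc j).neg
  have hgle : ∀ w j, -u w j ≤ g w := fun w j =>
    Finset.le_sup' (fun j => -u w j) (Finset.mem_univ j)
  have hgatt : ∀ w, ∃ j, g w = -u w j := fun w => by
    obtain ⟨j, -, hj⟩ := Finset.exists_mem_eq_sup' (s := Finset.univ)
      ⟨(0 : Fin (m + 2)), Finset.mem_univ _⟩ (fun j => -u w j)
    exact ⟨j, hj⟩
  have hgsmul : ∀ (a : ℝ) w, 0 ≤ a → g (a • w) = a * g w := by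
    intro a w ha
    apply le_antisymm
    · obtain ⟨j, hj⟩ := hgatt (a • w)
      rw [hj, hsmul, ← mul_neg]
      exact mul_le_mul_of_nonneg_left (hgle w j) ha
    · obtain ⟨j, hj⟩ := hgatt w
      rw [hj, mul_neg, ← hsmul]
      exact hgle _ j
  have hgpos : ∀ w, w ≠ 0 → 0 < g w := by
    intro w hw
    by_contra hcon
    have hnn : ∀ j ∈ Finset.univ, 0 ≤ u w j := fun j _ => by
      have := hgle w j; linarith
    have h0 := (Finset.sum_eq_zero_iff_of_nonneg hnn).1 (husum w)
    apply hw
    ext j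
    simpa [hus] using h0 j.succ (Finset.mem_univ _)
  have hg0 : g 0 = 0 := by
    have := hgsmul 0 0 le_rfl
    simpa using this
  let W : (ι → ℝ) → EuclideanSpace ℝ (Fin (m + 1)) := fun s =>
    WithLp.toLp 2 (fun j : Fin (m + 1) => s (e j.succ) - 1 / M)
  have hWc : Continuous W := by fun_prop
  have huW : ∀ s ∈ closedSimplex B, ∀ j, u (W s) j = s (e j) - 1 / M := by
    intro s hs j
    refine Fin.cases ?_ (fun j => ?_) j
    · have h1 := hs.2.2
      rw [hsumB, Fin.sum_univ_succ] at h1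
      rw [hu0]
      simp only [W, Finset.sum_sub_distrib]
      simp only [Finset.sum_const, Finset.card_univ, Fintype.card_fin, nsmul_eq_mul]
      have : (((m + 1 : ℕ) : ℝ)) * (1 / M) = 1 - 1 / M := by
        rw [hM]; field_simp; push_cast; ring
      rw [this]
      linarith
    · rw [hus]
  -- Rescaling along rays so that the boundary `g = 1 / M` goes to norm 1; the factor `g w` gives
  -- continuity at the origin, unlike plain normalization.
  let κ : EuclideanSpace ℝ (Fin (m + 1)) → EuclideanSpace ℝ (Fin (m + 1)) := fun w =>
    (M * g w / ‖w‖) • w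
  have hκn : ∀ w, ‖κ w‖ = |M * g w| := by
    intro w
    by_cases hw : w = 0
    · simp [κ, hw, hg0]
    · have : ‖w‖ ≠ 0 := norm_ne_zero_iff.2 hw
      simp only [κ, norm_smul, Real.norm_eq_abs, abs_div, abs_norm]
      field_simp
  have hκc : Continuous κ := by
    refine continuous_iff_continuousAt.2 fun w => ?_
    by_cases hw : w = 0
    · subst hw
      have h0 : κ 0 = 0 := by simp [κ]
      rw [ContinuousAt, h0, tendsto_zero_iff_norm_tendsto_zero]
      simp only [hκn]
      have : Continuous fun w => |M * g w| := by fun_prop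
      have := this.tendsto 0
      simpa [hg0] using this
    · exact ((continuousAt_const.mul hgc.continuousAt).div continuous_norm.continuousAt
        (norm_ne_zero_iff.2 hw)).smul continuousAt_id
  have hne : ∀ t : StdSphere m, (t : EuclideanSpace ℝ (Fin (m + 1))) ≠ 0 := fun t h => by
    have := t.2
    rw [h] at this
    simp at this
  let σ : StdSphere m → ι → ℝ := fun t v =>
    if h : v ∈ B then 1 / M + u t (e.symm ⟨v, h⟩) / (M * g t) else 0
  have hσe : ∀ t j, σ t (e j) = 1 / M + u t j / (M * g t) := fun t j => by
    simp [σ, (e j).2]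
  have hσc : Continuous σ := by
    refine continuous_pi fun v => ?_
    by_cases hv : v ∈ B
    · simp only [σ, dif_pos hv]
      refine continuous_const.add (Continuous.div ((huc _).comp continuous_subtype_val)
        (continuous_const.mul (hgc.comp continuous_subtype_val)) fun t => ?_)
      exact (mul_pos hMpos (hgpos _ (hne t))).ne'
    · simp only [σ, dif_neg hv]; exact continuous_const
  refine ⟨⟨fun s => κ (W s), hκc.comp hWc⟩, ⟨σ, hσc⟩, fun t => ⟨⟨fun v => ?_, fun v hv => ?_, ?_⟩, ?_⟩,
    fun s hs hv => ?_⟩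
  · have hg := hgpos _ (hne t)
    by_cases hv : v ∈ B
    · simp only [ContinuousMap.coe_mk, σ, dif_pos hv]
      have h1 := hgle t (e.symm ⟨v, hv⟩)
      have : 1 / M + u t (e.symm ⟨v, hv⟩) / (M * g t)
          = (g t + u t (e.symm ⟨v, hv⟩)) / (M * g t) := by
        field_simp
      rw [this]
      exact div_nonneg (by linarith) (by positivity)
    · simp [σ, hv]
  · simp [σ, hv]
  · rw [hsumB]
    simp only [ContinuousMap.coe_mk, hσe, Finset.sum_add_distrib, ← Finset.sum_div, husum]
    simp only [Finset.sum_const, Finset.card_univ, Fintype.card_fin, nsmul_eq_mul]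
    rw [hM]; push_cast; field_simp; simp
  · obtain ⟨j, hj⟩ := hgatt t
    have hg := hgpos _ (hne t)
    refine ⟨e j, (e j).2, ?_⟩
    simp only [ContinuousMap.coe_mk, hσe]
    have : u t j = -g t := by linarith
    rw [this]
    field_simp
    simp
  · obtain ⟨v, hvB, hv⟩ := hv
    have hgW : g (W s) = 1 / M := by
      apply le_antisymm
      · obtain ⟨j, hj⟩ := hgatt (W s)
        rw [hj, huW s hs]
        have := hs.1 (e j)
        linarith
      · have := hgle (W s) (e.symm ⟨v, hvB⟩)
        rw [huW s hs] at this
        simpa [hv] using this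
    have hW0 : W s ≠ 0 := by
      intro h
      rw [h, hg0] at hgW
      have : 0 < 1 / M := by positivity
      linarith
    have hWn : ‖W s‖ ≠ 0 := norm_ne_zero_iff.2 hW0
    have hκ : κ (W s) = ‖W s‖⁻¹ • W s := by
      simp only [κ, hgW]
      congr 1
      field_simp
    refine ⟨?_, ?_⟩
    · simp only [ContinuousMap.coe_mk, mem_sphere_iff_norm, sub_zero, hκn, hgW]
      rw [mul_one_div_cancel hMpos.ne', abs_one]
    · funext v
      by_cases hvB : v ∈ B
      · obtain ⟨j, hj⟩ : ∃ j, (e j : ι) = v := ⟨e.symm ⟨v, hvB⟩, by simp⟩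
        subst hj
        simp only [ContinuousMap.coe_mk, hσe]
        rw [hκ, hgsmul _ _ (by positivity), hsmul, hgW, huW s hs]
        field_simp
        ring
      · simp [σ, hvB, hs.2.1 v hvB]

/-! ### Stability of asphericity, neighborhoods of graphs, refinements of covers -/

/-- A map `τ` of a space to itself is `m`-aspheric from neighborhoods of `K` to neighborhoods
of `K'`. -/
def AsphericAlong {E : Type*} [TopologicalSpace E] (m : ℕ) (τ : E → E) (K K' : Set E) : Prop :=
  ∀ U, IsOpen U → K' ⊆ U → ∃ V, IsOpen V ∧ K ⊆ V ∧ ∀ f : C(StdSphere m, E), (∀ s, f s ∈ V) →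
    ∃ g : C(StdSphere m, U), (∀ s, (g s : E) = τ (f s)) ∧ g.Nullhomotopic

section LocallyConvex

variable {E : Type*} [AddCommGroup E] [Module ℝ E] [TopologicalSpace E] [IsTopologicalAddGroup E]
  [ContinuousSMul ℝ E] [LocallyConvexSpace ℝ E]

/-- Asphericity of a single fiber map passes to all maps close to it. -/
theorem AsphericAlong.exists_uniform {X : Type*} [TopologicalSpace X] {m : ℕ} {T : X × E → E}
    (hT : Continuous T) {x : X} {K K' : Set E} (hK : IsCompact K) (hK' : IsCompact K')
    (hTK : ∀ q ∈ K, T (x, q) ∈ K') (hA : AsphericAlong m (fun q => T (x, q)) K K')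
    {U : Set E} (hU : IsOpen U) (hKU : K' ⊆ U) :
    ∃ (N : Set X) (V : Set E), IsOpen N ∧ x ∈ N ∧ IsOpen V ∧ K ⊆ V ∧
      (∀ q ∈ V, convexHull ℝ ((fun y => T (y, q)) '' N) ⊆ U) ∧
      ∀ f φ : C(StdSphere m, E), (∀ t, f t ∈ V) →
        (∀ t, φ t ∈ convexHull ℝ ((fun y => T (y, f t)) '' N)) →
        ∃ Φ : C(StdSphere m, U), (∀ t, (Φ t : E) = φ t) ∧ Φ.Nullhomotopic := by
  obtain ⟨S, hS, hSU⟩ := compact_open_separated_add_right hK' hU hKU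
  obtain ⟨S', hS', hSS⟩ := exists_nhds_zero_half hS
  obtain ⟨ω, ⟨hω0, hωo, hωc⟩, hωS⟩ := (LocallyConvexSpace.convex_open_basis_zero ℝ E).mem_iff.1 hS'
  -- The room between `K'` and `U` is used twice: spheres contract inside `U' = K' + ω`, and one
  -- more error from `ω` still stays in `U`.
  set U' : Set E := {z | ∃ k ∈ K', z - k ∈ ω} with hU'
  have hU'o : IsOpen U' := by
    have : U' = ⋃ k ∈ K', (fun z => z - k) ⁻¹' ω := by ext; simp [hU']
    rw [this]
    exact isOpen_biUnion fun k _ => hωo.preimage (by fun_prop)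
  have hU'U : ∀ z ∈ U', ∀ d ∈ ω, z + d ∈ U := by
    rintro z ⟨k, hk, hz⟩ d hd
    apply hSU
    have : z + d = k + ((z - k) + d) := by abel
    rw [this]
    exact Set.add_mem_add hk (hSS _ (hωS hz) _ (hωS hd))
  have hK'U' : K' ⊆ U' := fun k hk => ⟨k, hk, by simpa using hω0⟩
  obtain ⟨V₁, hV₁o, hKV₁, hV₁⟩ := hA U' hU'o hK'U'
  have hD : IsOpen {p : X × E | T p - T (x, p.2) ∈ ω} := hωo.preimage (by fun_prop)
  obtain ⟨N, V₃, hN, hV₃, hxN, hKV₃, hNV⟩ := generalized_tube_lemma (isCompact_singleton (x := x))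
    hK hD (by
      rintro ⟨y, q⟩ ⟨hy, hq⟩
      have hy' : y = x := hy
      subst hy'
      simpa using hω0)
  have hV₂ : IsOpen {q | T (x, q) ∈ U'} := hU'o.preimage (by fun_prop)
  have hhull : ∀ q ∈ V₃, ∀ z ∈ convexHull ℝ ((fun y => T (y, q)) '' N), z - T (x, q) ∈ ω := by
    intro q hq
    have hc : Convex ℝ {z | z - T (x, q) ∈ ω} := by
      have := hωc.translate_preimage_left (-T (x, q))
      simp only [sub_eq_add_neg]
      exact this
    refine convexHull_min ?_ hc
    rintro _ ⟨y, hy, rfl⟩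
    exact hNV (mk_mem_prod hy hq)
  refine ⟨N, V₁ ∩ {q | T (x, q) ∈ U'} ∩ V₃, hN, hxN rfl, (hV₁o.inter hV₂).inter hV₃,
    fun q hq => ⟨⟨hKV₁ hq, hK'U' (hTK q hq)⟩, hKV₃ hq⟩, fun q hq z hz => ?_, fun f φ hf hφ => ?_⟩
  · simpa using hU'U _ hq.1.2 _ (hhull q hq.2 z hz)
  · obtain ⟨g, hg, z, hgz⟩ := hV₁ f fun s => (hf s).1.1
    -- The segment from `φ t` to `T (x, f t)` stays in `T (x, f t) + ω`, hence in `U`. So `φ` is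
    -- homotopic in `U` to the map contracted by the hypothesis.
    have hmem : ∀ (r : unitInterval) t,
        φ t + (r : ℝ) • (T (x, f t) - φ t) ∈ U := by
      intro r t
      have h1 := hhull _ (hf t).2 _ (hφ t)
      have h2 := hωc h1 hω0 (sub_nonneg.2 r.2.2) r.2.1 (by ring)
      have h3 := hU'U _ (hf t).1.2 _ h2
      convert h3 using 1
      module
    have hsub : U' ⊆ U := fun z hz => by simpa using hU'U z hz 0 hω0
    let ι' : C(U', U) := ⟨Set.inclusion hsub, continuous_inclusion hsub⟩
    let Φ : C(StdSphere m, U) := ⟨fun t => ⟨φ t, by simpa using hmem 0 t⟩, by fun_prop⟩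
    refine ⟨Φ, fun t => rfl, ι' z, ?_⟩
    have h1 : Φ.Homotopic (ι'.comp g) := ⟨{
      toFun := fun p => ⟨φ p.2 + (p.1 : ℝ) • (T (x, f p.2) - φ p.2), hmem p.1 p.2⟩
      continuous_toFun := by fun_prop
      map_zero_left := fun t => by ext1; simp [Φ]
      map_one_left := fun t => by
        ext1
        simp [ι', hg] }⟩
    exact h1.trans ((ContinuousMap.Homotopic.refl ι').comp hgz)

end LocallyConvex

/-- Local neighborhoods of the fibers of a multivalued map can be combined to a neighborhood of
its graph. -/
theorem exists_open_graph_nhd {X E : Type*} [TopologicalSpace X] [NormalSpace X]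
    [ParacompactSpace X] [TopologicalSpace E] (H : X → Set E) (N : X → Set X) (V : X → Set E)
    (hN : ∀ x, IsOpen (N x)) (hxN : ∀ x, x ∈ N x) (hV : ∀ x, IsOpen (V x))
    (hHV : ∀ x, H x ⊆ V x) (husc : ∀ U, IsOpen U → IsOpen {x | H x ⊆ U}) :
    ∃ W : Set (X × E), IsOpen W ∧ (∀ x, ∀ q ∈ H x, (x, q) ∈ W) ∧
      ∃ 𝒰 : Set (Set X), (∀ C ∈ 𝒰, IsOpen C) ∧ ⋃₀ 𝒰 = univ ∧
        ∀ C ∈ 𝒰, ∃ x, C ⊆ N x ∧ ∀ x' ∈ C, ∀ q, (x', q) ∈ W → q ∈ V x := by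
  obtain ⟨f, hf⟩ := PartitionOfUnity.exists_isSubordinate isClosed_univ
    (fun x => N x ∩ {x' | H x' ⊆ V x}) (fun x => (hN x).inter (husc _ (hV x)))
    (fun x _ => mem_iUnion.2 ⟨x, hxN x, hHV x⟩)
  -- `W` demands `q ∈ V a` for every `a` whose closed support contains the base point; local
  -- finiteness of the supports makes this an open condition.
  refine ⟨(⋃ a, tsupport (f a) ×ˢ (V a)ᶜ)ᶜ, ?_, ?_, range fun a => Function.support (f a), ?_, ?_, ?_⟩
  · rw [isOpen_compl_iff]
    refine LocallyFinite.isClosed_iUnion ?_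
      fun a => (isClosed_tsupport _).prod (hV a).isClosed_compl
    intro p
    obtain ⟨S, hS, hfin⟩ := f.locallyFinite_tsupport p.1
    refine ⟨Prod.fst ⁻¹' S, continuous_fst.continuousAt.preimage_mem_nhds hS, hfin.subset ?_⟩
    rintro a ⟨q, hq, hqS⟩
    exact ⟨q.1, hq.1, hqS⟩
  · intro x q hq
    simp only [mem_compl_iff, mem_iUnion, not_exists]
    rintro a ⟨ha, hqa⟩
    exact hqa ((hf a ha).2 hq)
  · rintro _ ⟨a, rfl⟩
    exact isOpen_ne.preimage (f a).continuous
  · refine eq_univ_of_forall fun x => ?_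
    obtain ⟨a, ha⟩ := f.exists_pos (mem_univ x)
    exact ⟨_, ⟨a, rfl⟩, ha.ne'⟩
  · rintro _ ⟨a, rfl⟩
    refine ⟨a, fun x hx => (hf a (subset_tsupport _ hx)).1, fun x hx q hq => ?_⟩
    by_contra hqV
    exact hq (mem_iUnion.2 ⟨a, subset_tsupport _ hx, hqV⟩)

/-- Every open cover of a metric space has an open barycentric refinement. -/
theorem exists_barycentric_refinement {X : Type*} [PseudoMetricSpace X] (𝒰 : Set (Set X))
    (ho : ∀ A ∈ 𝒰, IsOpen A) (hc : ⋃₀ 𝒰 = univ) :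
    ∃ 𝒱 : Set (Set X), (∀ B ∈ 𝒱, IsOpen B) ∧ ⋃₀ 𝒱 = univ ∧
      ∀ x, ∃ A ∈ 𝒰, ∀ B ∈ 𝒱, x ∈ B → B ⊆ A := by
  have h : ∀ x : X, ∃ r : ℝ, 0 < r ∧ r ≤ 1 ∧ ∃ A ∈ 𝒰, Metric.ball x r ⊆ A := by
    intro x
    obtain ⟨A, hA, hx⟩ := mem_sUnion.1 (hc ▸ mem_univ x : x ∈ ⋃₀ 𝒰)
    obtain ⟨r, hr, hrA⟩ := Metric.isOpen_iff.1 (ho A hA) x hx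
    exact ⟨min r 1, by positivity, min_le_right _ _, A, hA,
      (Metric.ball_subset_ball (min_le_left _ _)).trans hrA⟩
  choose r hr hr1 A hA hrA using h
  refine ⟨range fun x => Metric.ball x (r x / 8), ?_, ?_, fun x => ?_⟩
  · rintro _ ⟨x, rfl⟩; exact Metric.isOpen_ball
  · exact eq_univ_of_forall fun x =>
      ⟨_, ⟨x, rfl⟩, Metric.mem_ball_self (by have := hr x; positivity)⟩
  · set S : Set ℝ := r '' {z | x ∈ Metric.ball z (r z / 8)} with hS
    have hbdd : BddAbove S := ⟨1, by rintro _ ⟨z, -, rfl⟩; exact hr1 z⟩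
    have hne : S.Nonempty := ⟨r x, x, Metric.mem_ball_self (by have := hr x; positivity), rfl⟩
    have hpos : 0 < sSup S := (hr x).trans_le (le_csSup hbdd
      ⟨x, Metric.mem_ball_self (by have := hr x; positivity), rfl⟩)
    -- Some ball through `x` has `r z` above half the supremum. Every other ball through `x` has `r
    -- y < 2 * r z`, and its points are within `(2/8 + 2/8 + 1/8) * r z` of `z`.
    obtain ⟨_, ⟨z, hz, rfl⟩, hzS⟩ := exists_lt_of_lt_csSup hne (half_lt_self hpos)
    refine ⟨A z, hA z, ?_⟩
    rintro _ ⟨y, rfl⟩ hxy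
    refine Subset.trans (fun p hp => ?_) (hrA z)
    have hy : r y ≤ sSup S := le_csSup hbdd ⟨y, hxy, rfl⟩
    have h1 : dist x z < r z / 8 := hz
    have h2 : dist x y < r y / 8 := hxy
    have h3 : dist p y < r y / 8 := hp
    have h4 := dist_triangle p y z
    have h5 := dist_triangle y x z
    rw [dist_comm y x] at h5
    have := hr z
    rw [Metric.mem_ball]
    linarith

/-! ### Closed simplices and extension over skeleta -/

section closedSimplex

variable {ι : Type*}

theorem isClosed_closedSimplex (B : Finset ι) : IsClosed (closedSimplex B) := by
  have : closedSimplex B = (⋂ v, {s : ι → ℝ | 0 ≤ s v}) ∩ (⋂ v, ⋂ (_ : v ∉ B), {s | s v = 0}) ∩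
      {s | ∑ v ∈ B, s v = 1} := by
    ext s; simp [closedSimplex, and_assoc]
  rw [this]
  refine ((isClosed_iInter fun v => ?_).inter (isClosed_iInter fun v => isClosed_iInter fun _ => ?_)
    ).inter ?_
  · exact isClosed_le continuous_const (continuous_apply v)
  · exact isClosed_eq (continuous_apply v) continuous_const
  · exact isClosed_eq (continuous_finsetSum _ fun v _ => continuous_apply v) continuous_const

theorem subset_of_mem_closedSimplex {B B' : Finset ι} {s : ι → ℝ} (hs : s ∈ closedSimplex B)
    (h : ∀ v ∈ B', s v ≠ 0) : B' ⊆ B := fun v hv => by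
  by_contra hvB
  exact h v hv (hs.2.1 v hvB)

theorem mem_closedSimplex_erase [DecidableEq ι] {B : Finset ι} {s : ι → ℝ}
    (hs : s ∈ closedSimplex B) {v : ι} (h : s v = 0) : s ∈ closedSimplex (B.erase v) := by
  refine ⟨hs.1, fun w hw => ?_, ?_⟩
  · by_cases hwv : w = v
    · rw [hwv, h]
    · exact hs.2.1 w fun hwB => hw (Finset.mem_erase.2 ⟨hwv, hwB⟩)
  · rw [Finset.sum_erase _ h, hs.2.2]

theorem nonempty_of_mem_closedSimplex {B : Finset ι} {s : ι → ℝ} (hs : s ∈ closedSimplex B) :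
    B.Nonempty := by
  rw [Finset.nonempty_iff_ne_empty]
  rintro rfl
  simpa using hs.2.2

end closedSimplex

theorem finsum_smul_eq_of_mem_closedSimplex {E ι : Type*} [AddCommGroup E] [Module ℝ E] {B : Finset ι} {s : ι → ℝ}
    (hs : s ∈ closedSimplex B) (z : ι → E) : ∑ᶠ v, s v • z v = ∑ v ∈ B, s v • z v := by
  refine finsum_eq_sum_of_support_subset _ fun v hv => ?_
  by_contra hvB
  exact hv (by simp [hs.2.1 v hvB])

/-- Maps that agree with `ψ` on the boundaries of the simplices of dimension `i + 1` combine to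
an extension of `ψ` from the skeleton of dimension `i`. -/
theorem exists_skeleton_extension {ι Z : Type*} {i : ℕ} {P : Finset ι → Prop} {ψ : (ι → ℝ) → Z}
    (G : ∀ B, P B → B.card = i + 2 → (ι → ℝ) → Z)
    (hG : ∀ B (hB : P B) (hc : B.card = i + 2), ∀ s ∈ closedSimplex B, (∃ v ∈ B, s v = 0) →
      G B hB hc s = ψ s) :
    ∃ g : (ι → ℝ) → Z,
      (∀ B, P B → B.card ≤ i + 1 → EqOn g ψ (closedSimplex B)) ∧
      ∀ B (hB : P B) (hc : B.card = i + 2), EqOn g (G B hB hc) (closedSimplex B) := by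
  classical
  -- `D s B` says that `s` is interior to the simplex `B`; then `B` is the support of `s`, so the
  -- choice below is forced.
  let D : (ι → ℝ) → Finset ι → Prop := fun s B =>
    P B ∧ B.card = i + 2 ∧ s ∈ closedSimplex B ∧ ∀ v ∈ B, s v ≠ 0
  refine ⟨fun s => if h : ∃ B, D s B then G h.choose h.choose_spec.1 h.choose_spec.2.1 s
    else ψ s, fun B hB hc s hs => ?_, fun B hB hc s hs => ?_⟩
  · have : ¬ ∃ B', D s B' := by
      rintro ⟨B', -, h2, -, h4⟩
      have := Finset.card_le_card (subset_of_mem_closedSimplex hs h4)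
      omega
    simp only [dif_neg this]
  · have huniq : ∀ B', D s B' → B' = B := by
      rintro B' ⟨-, h2, -, h4⟩
      exact Finset.eq_of_subset_of_card_le (subset_of_mem_closedSimplex hs h4) (by omega)
    by_cases hbd : ∃ v ∈ B, s v = 0
    · have : ¬ ∃ B', D s B' := by
        rintro ⟨B', hB'⟩
        obtain ⟨v, hv, hv0⟩ := hbd
        have h4 := hB'.2.2.2
        rw [huniq B' hB'] at h4
        exact h4 v hv hv0
      simp only [dif_neg this]
      exact (hG B hB hc s hs hbd).symm
    · push Not at hbd
      have h : ∃ B', D s B' := ⟨B, hB, hc, hs, hbd⟩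
      simp only [dif_pos h]
      have := huniq _ h.choose_spec
      congr! 3

/-! ### Maps of nerves close to the graphs of the filtration -/

section Nerve

variable {E : Type*} [AddCommGroup E] [Module ℝ E] [TopologicalSpace E] [IsTopologicalAddGroup E]
  [ContinuousSMul ℝ E] [LocallyConvexSpace ℝ E]

/-- For a sufficiently fine cover of `X`, the `i`-skeleton of its nerve can be mapped close to the
graph of the `i`-th member of a filtration. -/
theorem exists_skeleton_map {X : Type u} [TopologicalSpace X]
    [NormalSpace X] [ParacompactSpace X] {n : ℕ} {H : ℕ → X → Set E} {T : ℕ → X × E → E}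
    (hT : ∀ i, Continuous (T i)) (hne : ∀ i x, (H i x).Nonempty)
    (hcpt : ∀ i x, IsCompact (H i x)) (husc : ∀ i U, IsOpen U → IsOpen {x | H i x ⊆ U})
    (hTH : ∀ i x, ∀ q ∈ H i x, T i (x, q) ∈ H (i + 1) x)
    (hA : ∀ i < n, ∀ x, AsphericAlong i (fun q => T i (x, q)) (H i x) (H (i + 1) x))
    (i : ℕ) (hi : i ≤ n) (W : Set (X × E)) (hW : IsOpen W) (hHW : ∀ x, ∀ q ∈ H i x, (x, q) ∈ W) :
    ∃ 𝒰 : Set (Set X), (∀ A ∈ 𝒰, IsOpen A) ∧ ⋃₀ 𝒰 = univ ∧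
      ∀ (ι : Type u) (O : ι → Set X), (∀ v, (O v).Nonempty) →
        (∀ B : Finset ι, (⋂ v ∈ B, O v).Nonempty → ∃ A ∈ 𝒰, ∀ v ∈ B, O v ⊆ A) →
        ∃ g : (ι → ℝ) → E, ∀ B : Finset ι, (⋂ v ∈ B, O v).Nonempty → B.card ≤ i + 1 →
          ContinuousOn g (closedSimplex B) ∧
          ∀ s ∈ closedSimplex B, ∀ x ∈ ⋂ v ∈ B, O v, (x, g s) ∈ W := by
  classical
  induction i generalizing W with
  | zero =>
    have h : ∀ a : X, ∃ N : Set X, IsOpen N ∧ a ∈ N ∧ ∃ q : E, ∀ x ∈ N, (x, q) ∈ W := by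
      intro a
      obtain ⟨q, hq⟩ := hne 0 a
      exact ⟨(fun x => (x, q)) ⁻¹' W, hW.preimage (by fun_prop), hHW a q hq, q, fun x hx => hx⟩
    choose N hN haN q hq using h
    refine ⟨range N, ?_, eq_univ_of_forall fun a => ⟨_, ⟨a, rfl⟩, haN a⟩, fun ι O hO hB => ?_⟩
    · rintro _ ⟨a, rfl⟩; exact hN a
    have h : ∀ v, ∃ z : E, ∀ x ∈ O v, (x, z) ∈ W := by
      intro v
      obtain ⟨_, ⟨a, rfl⟩, ha⟩ := hB {v} (by simpa using hO v)
      exact ⟨q a, fun x hx => hq a x (ha v (by simp) hx)⟩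
    choose z hz using h
    -- Only the vertices matter here; the linear formula is a convenient total function with the
    -- prescribed values there.
    refine ⟨fun s => ∑ᶠ v, s v • z v, fun B hBne hBc => ⟨?_, fun s hs x hx => ?_⟩⟩
    · refine ContinuousOn.congr (f := fun s => ∑ v ∈ B, s v • z v) (by fun_prop) fun s hs => ?_
      exact finsum_smul_eq_of_mem_closedSimplex hs z
    · have hc : B.card = 1 := le_antisymm hBc (nonempty_of_mem_closedSimplex hs).card_pos
      obtain ⟨v, rfl⟩ := Finset.card_eq_one.1 hc
      have h1 : s v = 1 := by simpa using hs.2.2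
      simp only [finsum_smul_eq_of_mem_closedSimplex hs z]
      simpa [h1] using hz v x (by simpa using hx)
  | succ i ih =>
    have hloc : ∀ x : X, ∃ (N : Set X) (V U : Set E), IsOpen N ∧ x ∈ N ∧ IsOpen V ∧ H i x ⊆ V ∧
        N ×ˢ U ⊆ W ∧ (∀ q ∈ V, convexHull ℝ ((fun y => T i (y, q)) '' N) ⊆ U) ∧
        ∀ f φ : C(StdSphere i, E), (∀ t, f t ∈ V) →
          (∀ t, φ t ∈ convexHull ℝ ((fun y => T i (y, f t)) '' N)) →
          ∃ Φ : C(StdSphere i, U), (∀ t, (Φ t : E) = φ t) ∧ Φ.Nullhomotopic := by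
      intro x
      obtain ⟨N₀, U, hN₀, hU, hxN₀, hHU, hNU⟩ := generalized_tube_lemma
        (isCompact_singleton (x := x)) (hcpt (i + 1) x) hW (by
          rintro ⟨y, q⟩ ⟨hy, hq⟩
          have hy' : y = x := hy
          subst hy'
          exact hHW y q hq)
      obtain ⟨N, V, hN, hxN, hV, hHV, h1, h2⟩ := (hA i (by omega) x).exists_uniform (hT i)
        (hcpt i x) (hcpt (i + 1) x) (hTH i x) hU hHU
      refine ⟨N ∩ N₀, V, U, hN.inter hN₀, ⟨hxN, hxN₀ rfl⟩, hV, hHV,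
        (prod_mono inter_subset_right Subset.rfl).trans hNU, fun q hq => ?_, fun f φ hf hφ => ?_⟩
      · exact (convexHull_mono (image_mono inter_subset_left)).trans (h1 q hq)
      · exact h2 f φ hf fun t => convexHull_mono (image_mono inter_subset_left) (hφ t)
    choose N V U hN hxN hV hHV hNU hhull hnull using hloc
    obtain ⟨W', hW', hHW', 𝒰₁, ho₁, hc₁, h𝒰₁⟩ :=
      exists_open_graph_nhd (H i) N V hN hxN hV hHV (husc i)
    obtain ⟨𝒰₂, ho₂, hc₂, h𝒰₂⟩ := ih (by omega) W' hW' hHW'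
    refine ⟨{A | ∃ A₁ ∈ 𝒰₁, ∃ A₂ ∈ 𝒰₂, A = A₁ ∩ A₂}, ?_, ?_, fun ι O hO hB => ?_⟩
    · rintro _ ⟨A₁, h₁, A₂, h₂, rfl⟩
      exact (ho₁ _ h₁).inter (ho₂ _ h₂)
    · refine eq_univ_of_forall fun x => ?_
      obtain ⟨A₁, h₁, hx₁⟩ := mem_sUnion.1 (hc₁ ▸ mem_univ x : x ∈ ⋃₀ 𝒰₁)
      obtain ⟨A₂, h₂, hx₂⟩ := mem_sUnion.1 (hc₂ ▸ mem_univ x : x ∈ ⋃₀ 𝒰₂)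
      exact ⟨_, ⟨A₁, h₁, A₂, h₂, rfl⟩, hx₁, hx₂⟩
    obtain ⟨g, hg⟩ := h𝒰₂ ι O hO fun B hBne => by
      obtain ⟨_, ⟨A₁, h₁, A₂, h₂, rfl⟩, h⟩ := hB B hBne
      exact ⟨A₂, h₂, fun v hv => (h v hv).trans inter_subset_right⟩
    -- One base point `x` serves a whole simplex, so asphericity of the single fiber map over `x`
    -- can be applied to its boundary.
    have hbase : ∀ B : Finset ι, (⋂ v ∈ B, O v).Nonempty → ∃ x, (∀ v ∈ B, O v ⊆ N x) ∧
        ∀ v ∈ B, ∀ x' ∈ O v, ∀ q, (x', q) ∈ W' → q ∈ V x := by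
      intro B hBne
      obtain ⟨_, ⟨A₁, h₁, A₂, h₂, rfl⟩, h⟩ := hB B hBne
      obtain ⟨x, hx, hx'⟩ := h𝒰₁ A₁ h₁
      exact ⟨x, fun v hv => ((h v hv).trans inter_subset_left).trans hx,
        fun v hv x' hx'O => hx' x' (h v hv hx'O).1⟩
    choose y hy using hO
    -- The push-forward of `g`, averaged over the base points `y v` with the barycentric coordinates
    -- as weights. This one formula serves all simplices, so it agrees on common faces.
    let ψ : (ι → ℝ) → E := fun s => ∑ᶠ v, s v • T i (y v, g s)
    have hψeq : ∀ B : Finset ι, ∀ s ∈ closedSimplex B, ψ s = ∑ v ∈ B, s v • T i (y v, g s) :=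
      fun B s hs => finsum_smul_eq_of_mem_closedSimplex hs _
    have hψc : ∀ B : Finset ι, (⋂ v ∈ B, O v).Nonempty → B.card ≤ i + 1 →
        ContinuousOn ψ (closedSimplex B) := by
      intro B hBne hBc
      refine ContinuousOn.congr (f := fun s => ∑ v ∈ B, s v • T i (y v, g s)) ?_ (hψeq B)
      have hgc := (hg B hBne hBc).1
      refine continuousOn_finsetSum _ fun v _ => (continuous_apply v).continuousOn.smul ?_
      exact (hT i).comp_continuousOn (continuousOn_const.prodMk hgc)
    have hψhull : ∀ (B : Finset ι) (x : X), (∀ v ∈ B, O v ⊆ N x) → ∀ s ∈ closedSimplex B,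
        ψ s ∈ convexHull ℝ ((fun y => T i (y, g s)) '' N x) := by
      intro B x hx s hs
      rw [hψeq B s hs]
      exact (convex_convexHull ℝ _).sum_mem (fun v _ => hs.1 v) hs.2.2 fun v hv =>
        subset_convexHull ℝ _ ⟨y v, hx v hv (hy v), rfl⟩
    have hext : ∀ B : Finset ι, (⋂ v ∈ B, O v).Nonempty → B.card = i + 2 → ∃ G : C(ι → ℝ, E),
        (∀ s, ∀ x ∈ ⋂ v ∈ B, O v, (x, G s) ∈ W) ∧
        ∀ s ∈ closedSimplex B, (∃ v ∈ B, s v = 0) → G s = ψ s := by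
      intro B hBne hBc
      obtain ⟨x, hxN', hxV⟩ := hbase B hBne
      have hsub : ∀ v, (⋂ v ∈ B, O v) ⊆ ⋂ w ∈ B.erase v, O w := fun v =>
        biInter_subset_biInter_left fun w hw => Finset.mem_of_mem_erase hw
      have hface : ∀ v ∈ B, (⋂ w ∈ B.erase v, O w).Nonempty ∧ (B.erase v).card ≤ i + 1 :=
        fun v hv => ⟨hBne.mono (hsub v), by rw [Finset.card_erase_of_mem hv]; omega⟩
      obtain ⟨c, σ, hσ, hcσ⟩ := exists_sphere_parametrization B i hBc
      have hcomp : ∀ k : (ι → ℝ) → E, (∀ v ∈ B, ContinuousOn k (closedSimplex (B.erase v))) →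
          Continuous (k ∘ σ) := by
        intro k hk
        have h1 : ContinuousOn k (⋃ v : B, closedSimplex (B.erase v)) :=
          (locallyFinite_of_finite _).continuousOn_iUnion
            (fun v => isClosed_closedSimplex _) fun v => hk v v.2
        refine h1.comp_continuous σ.continuous fun t => ?_
        obtain ⟨ht, v, hv, hv0⟩ := hσ t
        exact mem_iUnion.2 ⟨⟨v, hv⟩, mem_closedSimplex_erase ht hv0⟩
      obtain ⟨Φ, hΦ, hΦn⟩ := hnull x
        ⟨g ∘ σ, hcomp g fun v hv => (hg _ (hface v hv).1 (hface v hv).2).1⟩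
        ⟨ψ ∘ σ, hcomp ψ fun v hv => hψc _ (hface v hv).1 (hface v hv).2⟩
        (fun t => by
          obtain ⟨ht, v, hv, hv0⟩ := hσ t
          obtain ⟨x', hx'⟩ := hBne
          exact hxV v hv x' (mem_iInter₂.1 hx' v hv) _
            ((hg _ (hface v hv).1 (hface v hv).2).2 _ (mem_closedSimplex_erase ht hv0) x'
              (hsub v hx')))
        (fun t => hψhull B x hxN' _ (hσ t).1)
      obtain ⟨F, hF⟩ := exists_extension_of_nullhomotopic Φ hΦn
      have hBne' : B.Nonempty := Finset.card_pos.1 (by omega)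
      -- `F` takes values in `U` everywhere, so nothing need be known about `c` off the boundary.
      refine ⟨⟨fun s => F (c s), by fun_prop⟩, fun s x' hx' => ?_, fun s hs hv => ?_⟩
      · obtain ⟨v, hv⟩ := hBne'
        exact hNU x (mk_mem_prod (hxN' v hv (mem_iInter₂.1 hx' v hv)) (F (c s)).2)
      · obtain ⟨h, hh⟩ := hcσ s hs hv
        have h1 := hF ⟨c s, h⟩
        simp only [ContinuousMap.coe_mk]
        rw [h1, hΦ]
        simp [hh]
    choose G hGW hGψ using hext
    obtain ⟨g', hg'1, hg'2⟩ : ∃ g' : (ι → ℝ) → E,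
        (∀ B : Finset ι, (⋂ v ∈ B, O v).Nonempty → B.card ≤ i + 1 → EqOn g' ψ (closedSimplex B)) ∧
        ∀ (B : Finset ι) (hB : (⋂ v ∈ B, O v).Nonempty) (hc : B.card = i + 2),
          EqOn g' (G B hB hc) (closedSimplex B) :=
      exists_skeleton_extension (P := fun B : Finset ι => (⋂ v ∈ B, O v).Nonempty)
        (fun B hB hc => G B hB hc) hGψ
    refine ⟨g', fun B hBne hBc => ?_⟩
    rcases Nat.lt_or_ge (i + 1) B.card with hlt | hle
    · have hc : B.card = i + 2 := by omega
      have heq := hg'2 B hBne hc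
      refine ⟨(G B hBne hc).continuous.continuousOn.congr heq, fun s hs x hx => ?_⟩
      rw [heq hs]
      exact hGW B hBne hc s x hx
    · have heq := hg'1 B hBne hle
      refine ⟨(hψc B hBne hle).congr heq, fun s hs x' hx' => ?_⟩
      rw [heq hs]
      obtain ⟨x, hxN', hxV⟩ := hbase B hBne
      obtain ⟨v, hv⟩ := nonempty_of_mem_closedSimplex hs
      have hx'v := mem_iInter₂.1 hx' v hv
      exact hNU x (mk_mem_prod (hxN' v hv hx'v)
        (hhull x _ (hxV v hv x' hx'v _ ((hg B hBne hle).2 s hs x' hx'))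
          (hψhull B x hxN' s hs)))

/-- Approximation of the last member of a filtration of length `n` over a metric space of covering
dimension at most `n`. -/
theorem exists_graph_approximation {X : Type u} [MetricSpace X] {n : ℕ} {H : ℕ → X → Set E}
    {T : ℕ → X × E → E} (hdim : CoveringDimLE X n)
    (hT : ∀ i, Continuous (T i)) (hne : ∀ i x, (H i x).Nonempty)
    (hcpt : ∀ i x, IsCompact (H i x)) (husc : ∀ i U, IsOpen U → IsOpen {x | H i x ⊆ U})
    (hTH : ∀ i x, ∀ q ∈ H i x, T i (x, q) ∈ H (i + 1) x)
    (hA : ∀ i < n, ∀ x, AsphericAlong i (fun q => T i (x, q)) (H i x) (H (i + 1) x))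
    {W : Set (X × E)} (hW : IsOpen W) (hHW : ∀ x, ∀ q ∈ H n x, (x, q) ∈ W) :
    ∃ g : C(X, E), ∀ x, (x, g x) ∈ W := by
  classical
  obtain ⟨𝒰, h𝒰o, h𝒰c, h𝒰⟩ := exists_skeleton_map hT hne hcpt husc hTH hA n le_rfl W hW hHW
  obtain ⟨𝒱₀, h₀o, h₀c, h₀⟩ := exists_barycentric_refinement 𝒰 h𝒰o h𝒰c
  obtain ⟨𝒱, hVo, hVc, hVref, hVcard⟩ := hdim 𝒱₀ h₀o h₀c
  let O : {B : Set X // B ∈ 𝒱 ∧ B.Nonempty} → Set X := Subtype.val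
  obtain ⟨f, hf⟩ := PartitionOfUnity.exists_isSubordinate isClosed_univ O (fun v => hVo _ v.2.1)
    (fun x _ => by
      obtain ⟨B, hB, hx⟩ := mem_sUnion.1 (hVc ▸ mem_univ x : x ∈ ⋃₀ 𝒱)
      exact mem_iUnion.2 ⟨⟨B, hB, x, hx⟩, hx⟩)
  obtain ⟨g, hg⟩ := h𝒰 _ O (fun v => v.2.2) (by
    rintro B ⟨x, hx⟩
    obtain ⟨A, hA, hxA⟩ := h₀ x
    refine ⟨A, hA, fun v hv => ?_⟩
    obtain ⟨C, hC, hvC⟩ := hVref _ v.2.1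
    exact hvC.trans (hxA C hC (hvC (mem_iInter₂.1 hx v hv))))
  have hcard : ∀ (B : Finset {B : Set X // B ∈ 𝒱 ∧ B.Nonempty}) (x : X), x ∈ ⋂ v ∈ B, O v →
      B.card ≤ n + 1 := by
    intro B x hx
    have h1 : ((B.map (Function.Embedding.subtype _) : Finset (Set X)) : Set (Set X)) ⊆
        {C ∈ 𝒱 | x ∈ C} := by
      intro C hC
      obtain ⟨v, hv, rfl⟩ := Finset.mem_map.1 (Finset.mem_coe.1 hC)
      exact ⟨v.2.1, mem_iInter₂.1 hx v hv⟩
    have h2 := (encard_le_encard h1).trans (hVcard x)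
    rw [encard_coe_eq_coe_finsetCard, Finset.card_map] at h2
    exact_mod_cast h2
  let κ : X → {B : Set X // B ∈ 𝒱 ∧ B.Nonempty} → ℝ := fun x v => f v x
  have hκc : Continuous κ := continuous_pi fun v => (f v).continuous
  have hκmem : ∀ x (B : Finset {B : Set X // B ∈ 𝒱 ∧ B.Nonempty}), (∀ v ∉ B, f v x = 0) →
      κ x ∈ closedSimplex B := by
    intro x B hB
    refine ⟨fun v => f.nonneg v x, hB, ?_⟩
    rw [← f.sum_eq_one (mem_univ x)]
    refine (finsum_eq_sum_of_support_subset _ fun v hv => ?_).symm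
    by_contra hvB
    exact hv (hB v hvB)
  have hsupp : ∀ x, x ∈ ⋂ v ∈ (f.locallyFinite.point_finite x).toFinset, O v := by
    intro x
    refine mem_iInter₂.2 fun v hv => hf v (subset_tsupport _ ?_)
    simpa using hv
  have hκsupp : ∀ x, κ x ∈ closedSimplex (f.locallyFinite.point_finite x).toFinset :=
    fun x => hκmem x _ fun v hv => by simpa using hv
  refine ⟨⟨fun x => g (κ x), continuous_iff_continuousAt.2 fun x₀ => ?_⟩, fun x => ?_⟩
  · obtain ⟨S, hS, hfin⟩ := f.locallyFinite x₀
    let 𝒜 : Set (Finset {B : Set X // B ∈ 𝒱 ∧ B.Nonempty}) :=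
      {A | A ⊆ hfin.toFinset ∧ (⋂ v ∈ A, O v).Nonempty}
    have h𝒜 : 𝒜.Finite := (hfin.toFinset.powerset.finite_toSet).subset fun A hA => by
      simpa using hA.1
    have : Finite 𝒜 := h𝒜
    -- `g` is continuous only on each closed simplex; near `x₀` finitely many of them, with closed
    -- preimages, suffice.
    have hcont : ContinuousOn (fun x => g (κ x)) (⋃ A : 𝒜, κ ⁻¹' closedSimplex A) := by
      refine (locallyFinite_of_finite _).continuousOn_iUnion
        (fun A => (isClosed_closedSimplex _).preimage hκc) fun A => ?_
      obtain ⟨x, hx⟩ := A.2.2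
      exact (hg A A.2.2 (hcard _ x hx)).1.comp hκc.continuousOn fun x hx => hx
    refine hcont.continuousAt (Filter.mem_of_superset hS fun x hx => ?_)
    refine mem_iUnion.2 ⟨⟨_, fun v hv => ?_, x, hsupp x⟩, hκsupp x⟩
    have hv' : f v x ≠ 0 := by simpa using hv
    simpa using ⟨x, hv', hx⟩
  · exact (hg _ ⟨x, hsupp x⟩ (hcard _ x (hsupp x))).2 _ (hκsupp x) x (hsupp x)

end Nerve

/-! ### Real sequences as an ambient space, and ANRs -/

/-- A separable metrizable space embeds into the space of real sequences. -/
theorem exists_isEmbedding_realSequences (Y : Type*) [TopologicalSpace Y]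
    [TopologicalSpace.MetrizableSpace Y] [TopologicalSpace.SeparableSpace Y] :
    ∃ e : Y → ℕ → ℝ, IsEmbedding e := by
  let _ := TopologicalSpace.metrizableSpaceMetric Y
  obtain ⟨e, he⟩ := Metric.PiNatEmbed.exists_embedding_to_hilbert_cube (X := Y)
  refine ⟨fun y n => e y n, ?_⟩
  exact (IsEmbedding.piMap fun _ : ℕ => (IsEmbedding.subtypeVal : IsEmbedding
    (Subtype.val : unitInterval → ℝ))).comp he

/-- By Tietze the retraction exists on the whole ambient space. The lift puts the space into the
universe over which the asphericity definitions quantify. -/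
theorem isANR_ulift_realSequences : IsANR (ULift.{w} (ℕ → ℝ)) where
  metrizable := Homeomorph.ulift.isEmbedding.metrizableSpace
  separable := by
    have : SecondCountableTopology (ULift.{w} (ℕ → ℝ)) :=
      Homeomorph.ulift.isEmbedding.secondCountableTopology
    infer_instance
  retract W _ _ _ e he := by
    let _ := TopologicalSpace.metrizableSpaceMetric W
    obtain ⟨r, hr⟩ := ContinuousMap.exists_extension' he
      (⟨ULift.down, continuous_uliftDown⟩ : C(ULift.{w} (ℕ → ℝ), ℕ → ℝ))
    refine ⟨univ, isOpen_univ, subset_univ _, ⟨fun p => ULift.up (r p), by fun_prop⟩, fun z _ => ?_⟩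
    exact congrArg ULift.up (congrFun hr z)

/-- The graph of a compact map is closed, also after an embedding of the target space. -/
theorem MultivaluedMap.IsCompactMap.isClosedEmbedding_graph {X : Type u} {Y : Type v} {E : Type*}
    [TopologicalSpace X] [TopologicalSpace Y] [TopologicalSpace E] [T2Space E]
    {F : MultivaluedMap X Y} (hF : F.IsCompactMap) {e : Y → E} (he : IsEmbedding e) :
    IsClosedEmbedding fun p : F.graph => ((p : X × Y).1, e (p : X × Y).2) := by
  refine ⟨(IsEmbedding.id.prodMap he).comp IsEmbedding.subtypeVal, ?_⟩
  rw [← isOpen_compl_iff, isOpen_iff_mem_nhds]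
  rintro ⟨x, q⟩ hq
  have hqx : Disjoint {q} (e '' F x) := by
    rw [disjoint_singleton_left]
    rintro ⟨y, hy, rfl⟩
    exact hq ⟨⟨(x, y), hy⟩, rfl⟩
  obtain ⟨V, U, hV, hU, hqV, hxU, hVU⟩ := SeparatedNhds.of_isCompact_isCompact
    isCompact_singleton ((hF.isCompact_apply x).image he.continuous) hqx
  have hN : {x' | F x' ⊆ e ⁻¹' U} ∈ 𝓝 x :=
    (hF.upperSemicontinuous _ (hU.preimage he.continuous)).mem_nhds (image_subset_iff.1 hxU)
  filter_upwards [prod_mem_nhds hN (hV.mem_nhds (hqV rfl))]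
  rintro ⟨x', q'⟩ ⟨hx', hq'⟩ ⟨⟨⟨x'', y⟩, hy⟩, h⟩
  simp only [Prod.mk.injEq] at h
  obtain ⟨rfl, rfl⟩ := h
  exact disjoint_left.1 hVU hq' (hx' hy)

/-- Approximate asphericity, for the embeddings into the space of real sequences. -/
theorem ApproxAsphericPair.asphericAlong {m : ℕ} {K K' : Type w} [TopologicalSpace K]
    [TopologicalSpace K'] {φ : C(K, K')} (h : ApproxAsphericPair m φ) {e : K → ℕ → ℝ}
    {e' : K' → ℕ → ℝ} (he : IsEmbedding e) (he' : IsEmbedding e') {τ : (ℕ → ℝ) → ℕ → ℝ}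
    (hτ : Continuous τ) (hτe : ∀ k, τ (e k) = e' (φ k)) :
    AsphericAlong m τ (range e) (range e') := by
  intro U hU hKU
  have hup : IsEmbedding (ULift.up : (ℕ → ℝ) → ULift.{w} (ℕ → ℝ)) :=
    Homeomorph.ulift.symm.isEmbedding
  obtain ⟨V, hV, -, hVf⟩ := h (ULift.{w} (ℕ → ℝ)) (ULift.{w} (ℕ → ℝ)) isANR_ulift_realSequences
    isANR_ulift_realSequences (ULift.up ∘ e) (ULift.up ∘ e') (hup.comp he) (hup.comp he') univ
    Filter.univ_mem ⟨fun p => ULift.up (τ p.1.down), by fun_prop⟩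
    (fun k _ => congrArg ULift.up (hτe k)) (ULift.down ⁻¹' U)
    ((hU.preimage continuous_uliftDown).mem_nhdsSet.2 (by rintro _ ⟨k, rfl⟩; exact hKU ⟨k, rfl⟩))
  obtain ⟨V', hV'o, hKV', hV'V⟩ := mem_nhdsSet_iff_exists.1 hV
  refine ⟨ULift.up ⁻¹' V', hV'o.preimage hup.continuous, ?_, fun f hf => ?_⟩
  · rintro _ ⟨k, rfl⟩; exact hKV' ⟨k, rfl⟩
  obtain ⟨g, hg, hgn⟩ := hVf ⟨fun s => ⟨ULift.up (f s), mem_univ _⟩, by fun_prop⟩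
    fun s => hV'V (hf s)
  refine ⟨ContinuousMap.comp ⟨fun p : (ULift.down ⁻¹' U : Set (ULift.{w} (ℕ → ℝ))) =>
    (⟨p.1.down, p.2⟩ : U), by fun_prop⟩ g, fun s => ?_, hgn.comp_right _⟩
  exact congrArg ULift.down (hg s)

/-- This makes the identity an admissible step when a filtration is prolonged beyond its length. -/
theorem ApproxAspheric.asphericAlong {m : ℕ} {K : Type w} [TopologicalSpace K]
    (h : ApproxAspheric m K) {e : K → ℕ → ℝ} (he : IsEmbedding e) :
    AsphericAlong m (fun q => q) (range e) (range e) := by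
  intro U hU hKU
  have hup : IsEmbedding (ULift.up : (ℕ → ℝ) → ULift.{w} (ℕ → ℝ)) :=
    Homeomorph.ulift.symm.isEmbedding
  obtain ⟨V, hV, hVf⟩ := h (ULift.{w} (ℕ → ℝ)) isANR_ulift_realSequences
    (ULift.up ∘ e) (hup.comp he) (ULift.down ⁻¹' U)
    ((hU.preimage continuous_uliftDown).mem_nhdsSet.2 (by rintro _ ⟨k, rfl⟩; exact hKU ⟨k, rfl⟩))
  obtain ⟨V', hV'o, hKV', hV'V⟩ := mem_nhdsSet_iff_exists.1 hV
  refine ⟨ULift.up ⁻¹' V', hV'o.preimage hup.continuous, ?_, fun f hf => ?_⟩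
  · rintro _ ⟨k, rfl⟩; exact hKV' ⟨k, rfl⟩
  obtain ⟨g, hg, hgn⟩ := hVf ⟨fun s => ULift.up (f s), by fun_prop⟩ fun s => hV'V (hf s)
  refine ⟨ContinuousMap.comp ⟨fun p : (ULift.down ⁻¹' U : Set (ULift.{w} (ℕ → ℝ))) =>
    (⟨p.1.down, p.2⟩ : U), by fun_prop⟩ g, fun s => ?_, hgn.comp_right _⟩
  exact congrArg ULift.down (hg s)

/-- A map to an ANR extends from a closed subset of a metrizable space to a neighborhood. -/
theorem IsANR.exists_neighborhood_extension {Y : Type v} [TopologicalSpace Y] (hY : IsANR Y)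
    {A M : Type*} [TopologicalSpace A] [TopologicalSpace M] [TopologicalSpace.MetrizableSpace M]
    {ε : A → M} (hε : IsClosedEmbedding ε) (f : C(A, Y)) :
    ∃ O : Set M, IsOpen O ∧ range ε ⊆ O ∧ ∃ F : C(O, Y), ∀ a (ha : ε a ∈ O), F ⟨ε a, ha⟩ = f a := by
  let _ := TopologicalSpace.metrizableSpaceMetric M
  have := hY.metrizable
  have := hY.separable
  obtain ⟨e, he⟩ := exists_isEmbedding_realSequences Y
  obtain ⟨d, hdc, hd⟩ : ∃ d : M → ℝ, Continuous d ∧ ∀ m, d m = 0 ↔ m ∈ range ε := by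
    -- `Metric.infDist` to the empty set is 0, so that case needs a positive constant.
    rcases (range ε).eq_empty_or_nonempty with h | h
    · exact ⟨fun _ => 1, continuous_const, fun m => by simp [h]⟩
    · refine ⟨fun m => Metric.infDist m (range ε), Metric.continuous_infDist_pt _, fun m => ?_⟩
      exact (hε.isClosed_range.mem_iff_infDist_zero h).symm
  obtain ⟨f', hf'⟩ := ContinuousMap.exists_extension' hε
    ((⟨e, he.continuous⟩ : C(Y, ℕ → ℝ)).comp f)
  -- `M` may be non-separable, so the retraction is used in the separable space `S`, whose slice at
  -- height 0 is a closed copy of `Y`. The height `d` lets the Tietze extension leave that copy off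
  -- `range ε`.
  let S : Set ((ℕ → ℝ) × ℝ) := {p | p.2 = 0 → p.1 ∈ range e}
  have hup : IsEmbedding (ULift.up : S → ULift.{v} S) := Homeomorph.ulift.symm.isEmbedding
  have hdown : IsEmbedding (ULift.down : ULift.{v} S → S) := Homeomorph.ulift.isEmbedding
  have : TopologicalSpace.MetrizableSpace (ULift.{v} S) := hdown.metrizableSpace
  have : SecondCountableTopology (ULift.{v} S) := hdown.secondCountableTopology
  let j : Y → ULift.{v} S := fun y => ULift.up ⟨(e y, 0), fun _ => ⟨y, rfl⟩⟩
  have hj : IsClosedEmbedding j := by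
    refine ⟨IsEmbedding.of_comp (f := j) (g := fun p => p.down.1.1) ?_ (by fun_prop) he, ?_⟩
    · exact hup.continuous.comp (by have := he.continuous; fun_prop)
    · have : range j = {p : ULift.{v} S | p.down.1.2 = 0} := by
        ext ⟨⟨⟨q, t⟩, hp⟩⟩
        constructor
        · rintro ⟨y, hy⟩
          rw [← hy]
          rfl
        · intro ht
          have ht' : t = 0 := ht
          subst ht'
          obtain ⟨y, hy⟩ := hp rfl
          exact ⟨y, by simp only at hy; subst hy; rfl⟩
      rw [this]
      exact isClosed_eq (by fun_prop) continuous_const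
  obtain ⟨O, hO, hjO, r, hr⟩ := hY.retract (ULift.{v} S) j hj
  have hf'ε : ∀ a, f' (ε a) = e (f a) := fun a => congrFun hf' a
  let Θ : C(M, ULift.{v} S) := ⟨fun m => ULift.up ⟨(f' m, d m), fun h => by
    obtain ⟨a, rfl⟩ := (hd m).1 h
    exact ⟨f a, (hf'ε a).symm⟩⟩, hup.continuous.comp (by fun_prop)⟩
  have hΘ : ∀ a, Θ (ε a) = j (f a) := by
    intro a
    have : d (ε a) = 0 := (hd _).2 ⟨a, rfl⟩
    simp [Θ, j, hf'ε, this]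
  refine ⟨Θ ⁻¹' O, hO.preimage Θ.continuous, ?_, ⟨fun p => r ⟨Θ p, p.2⟩, by fun_prop⟩, fun a ha => ?_⟩
  · rintro _ ⟨a, rfl⟩
    rw [mem_preimage, hΘ]
    exact hjO ⟨_, rfl⟩
  · have h1 : j (f a) ∈ O := hjO ⟨_, rfl⟩
    rw [← hr (f a) h1]
    simp only [ContinuousMap.coe_mk]
    congr 1
    exact Subtype.ext (hΘ a)

/-! ### The filtration inside the space of real sequences -/

/-- A compact filtration is modelled by a sequence of maps to the space of real sequences, which
is constant from the length of the filtration on. -/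
theorem SingularFiltration.exists_realSequences_model {X : Type u} {Y : Type v}
    [TopologicalSpace X] [TopologicalSpace.MetrizableSpace X] [TopologicalSpace Y]
    {F : MultivaluedMap X Y} {n : ℕ} (ℱ : SingularFiltration.{u, v, w} F n)
    (hc : ℱ.IsCompactFiltration) (hA : ℱ.IsApproxConnected) :
    ∃ (e : ℱ.space (Fin.last n) → ℕ → ℝ) (H : ℕ → X → Set (ℕ → ℝ))
      (T : ℕ → X × (ℕ → ℝ) → ℕ → ℝ),
      IsEmbedding e ∧ (∀ i, n ≤ i → ∀ x, H i x = e '' ℱ.map (Fin.last n) x) ∧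
      (∀ i, Continuous (T i)) ∧ (∀ i x, (H i x).Nonempty) ∧ (∀ i x, IsCompact (H i x)) ∧
      (∀ i U, IsOpen U → IsOpen {x | H i x ⊆ U}) ∧
      (∀ i x, ∀ q ∈ H i x, T i (x, q) ∈ H (i + 1) x) ∧
      (∀ i < n, ∀ x, AsphericAlong i (fun q => T i (x, q)) (H i x) (H (i + 1) x)) ∧
      ((∀ x k, n ≤ k → ApproxAspheric k (ℱ.map (Fin.last n) x)) →
        ∀ i, n ≤ i → ∀ x, AsphericAlong i (fun q => T i (x, q)) (H i x) (H (i + 1) x)) := by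
  let _ := TopologicalSpace.metrizableSpaceMetric X
  have := ℱ.metrizable
  have := ℱ.separable
  choose e he using fun i => exists_isEmbedding_realSequences (ℱ.space i)
  -- Indices are frozen at `n`, so the steps from `n` on can be identity maps.
  let j : ℕ → Fin (n + 1) := fun i => ⟨min i n, by omega⟩
  have hjlt : ∀ i (h : i < n), j i = Fin.castSucc ⟨i, h⟩ ∧ j (i + 1) = Fin.succ ⟨i, h⟩ :=
    fun i h => ⟨Fin.ext (min_eq_left h.le), Fin.ext (min_eq_left h)⟩
  have hjge : ∀ i, n ≤ i → j i = Fin.last n := fun i h => Fin.ext (min_eq_right h)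
  let K : Fin (n + 1) → X → Set (ℕ → ℝ) := fun i x => e i '' ℱ.map i x
  have hrange : ∀ i x, K i x = range fun y : ℱ.map i x => e i y := fun i x => by
    simp only [K, image_eq_range]
  have hemb : ∀ i x, IsEmbedding fun y : ℱ.map i x => e i y := fun i x =>
    (he i).comp IsEmbedding.subtypeVal
  have hstep : ∀ i, ∃ T : X × (ℕ → ℝ) → ℕ → ℝ, Continuous T ∧
      (∀ x, ∀ q ∈ K (j i) x, T (x, q) ∈ K (j (i + 1)) x) ∧
      (i < n → ∀ x, AsphericAlong i (fun q => T (x, q)) (K (j i) x) (K (j (i + 1)) x)) ∧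
      ((∀ x k, n ≤ k → ApproxAspheric k (ℱ.map (Fin.last n) x)) →
        n ≤ i → ∀ x, AsphericAlong i (fun q => T (x, q)) (K (j i) x) (K (j (i + 1)) x)) := by
    intro i
    rcases Nat.lt_or_ge i n with hi | hi
    · obtain ⟨h1, h2⟩ := hjlt i hi
      rw [h1, h2]
      set l : Fin n := ⟨i, hi⟩
      obtain ⟨T, hT⟩ := ContinuousMap.exists_extension'
        ((hc l.castSucc).isClosedEmbedding_graph (he l.castSucc))
        (⟨fun p => e l.succ ((ℱ.trans l).toMap p : X × ℱ.space l.succ).2,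
          (he l.succ).continuous.comp (by fun_prop)⟩ : C((ℱ.map l.castSucc).graph, ℕ → ℝ))
      have hTe : ∀ x (y : ℱ.map l.castSucc x),
          T (x, e l.castSucc y) = e l.succ ((ℱ.trans l).fiber x y) := fun x y =>
        congrFun hT ⟨(x, y), y.2⟩
      refine ⟨T, T.continuous, ?_, fun _ x => ?_, fun _ h => absurd h (by omega)⟩
      · rintro x _ ⟨y, hy, rfl⟩
        exact ⟨_, ((ℱ.trans l).fiber x ⟨y, hy⟩).2, (hTe x ⟨y, hy⟩).symm⟩
      · rw [hrange, hrange]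
        exact (hA x l).asphericAlong (hemb _ x) (hemb _ x) (by fun_prop) (hTe x)
    · rw [hjge i hi, hjge (i + 1) (by omega)]
      refine ⟨Prod.snd, continuous_snd, fun x q hq => hq, fun h => absurd h (by omega),
        fun h _ x => ?_⟩
      rw [hrange]
      exact (h x i hi).asphericAlong (hemb _ x)
  choose T hT hTK hTA hTA' using hstep
  refine ⟨e (Fin.last n), fun i => K (j i), T, he _, fun i hi x => ?_, hT,
    fun i x => ((ℱ.map (j i)).nonempty_apply x).image _,
    fun i x => ((hc (j i)).isCompact_apply x).image (he _).continuous, fun i U hU => ?_,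
    hTK, hTA, fun h i => hTA' i h⟩
  · simp only [K]
    rw [hjge i hi]
  · simp only [K, image_subset_iff]
    exact (hc (j i)).upperSemicontinuous _ (hU.preimage (he _).continuous)

/-! ### Approximate extension and finite-dimensional compacta -/

/-- A continuous map to a normed space, defined on a subset of a metrizable space, can be replaced
by a map close to it that is defined on a neighborhood of the subset. -/
theorem exists_approximate_neighborhood_extension {A M Y : Type*} [TopologicalSpace A]
    [TopologicalSpace M] [TopologicalSpace.MetrizableSpace M] [NormedAddCommGroup Y]
    [NormedSpace ℝ Y] {ε : A → M} (hε : IsInducing ε) {τ : A → Y} (hτ : Continuous τ)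
    {𝒢 : Set (M × Y)} (h𝒢 : IsOpen 𝒢) (hετ : ∀ a, (ε a, τ a) ∈ 𝒢) :
    ∃ W : Set M, IsOpen W ∧ range ε ⊆ W ∧ ∃ F : C(W, Y), ∀ m : W, ((m : M), F m) ∈ 𝒢 := by
  let _ := TopologicalSpace.metrizableSpaceMetric M
  have h : ∀ a, ∃ r ρ : ℝ, 0 < r ∧ r ≤ 1 ∧ Metric.ball (ε a) r ×ˢ Metric.ball (τ a) ρ ⊆ 𝒢 ∧
      ∀ a', dist (ε a') (ε a) < r → τ a' ∈ Metric.ball (τ a) ρ := by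
    intro a
    obtain ⟨ρ, hρ, hρ𝒢⟩ := Metric.isOpen_iff.1 h𝒢 _ (hετ a)
    have h1 : τ ⁻¹' Metric.ball (τ a) ρ ∈ 𝓝 a :=
      hτ.continuousAt.preimage_mem_nhds (Metric.ball_mem_nhds _ hρ)
    rw [hε.nhds_eq_comap, (Metric.nhds_basis_ball.comap ε).mem_iff] at h1
    obtain ⟨r, hr, hrτ⟩ := h1
    refine ⟨min (min r ρ) 1, ρ, by positivity, min_le_right _ _, ?_, fun a' ha' => ?_⟩
    · rw [← ball_prod_same] at hρ𝒢
      refine (prod_mono (Metric.ball_subset_ball ?_) Subset.rfl).trans hρ𝒢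
      exact (min_le_left _ _).trans (min_le_right _ _)
    · exact hrτ (show dist (ε a') (ε a) < r from
        ha'.trans_le ((min_le_left _ _).trans (min_le_left _ _)))
  choose r ρ hr hr1 hball hτball using h
  let W : Set M := ⋃ a, Metric.ball (ε a) (r a / 8)
  let t : W → Set Y := fun m => convexHull ℝ (τ '' {a | (m : M) ∈ Metric.ball (ε a) (r a / 8)})
  obtain ⟨F, hF⟩ := exists_continuous_forall_mem_convex_of_local_const (t := t)
    (fun m => convex_convexHull ℝ _) (fun m => by
      obtain ⟨a, ha⟩ := mem_iUnion.1 m.2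
      refine ⟨τ a, ?_⟩
      filter_upwards [continuous_subtype_val.continuousAt.preimage_mem_nhds
        (Metric.isOpen_ball.mem_nhds ha)] with m' hm'
      exact subset_convexHull ℝ _ ⟨a, hm', rfl⟩)
  refine ⟨W, isOpen_iUnion fun a => Metric.isOpen_ball, ?_, F, fun m => ?_⟩
  · rintro _ ⟨a, rfl⟩
    exact mem_iUnion.2 ⟨a, Metric.mem_ball_self (by have := hr a; positivity)⟩
  set S : Set ℝ := r '' {a | (m : M) ∈ Metric.ball (ε a) (r a / 8)} with hS
  have hbdd : BddAbove S := ⟨1, by rintro _ ⟨z, -, rfl⟩; exact hr1 z⟩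
  obtain ⟨a₀, ha₀⟩ := mem_iUnion.1 m.2
  have hpos : 0 < sSup S := (hr a₀).trans_le (le_csSup hbdd ⟨a₀, ha₀, rfl⟩)
  -- With `r z` above half the supremum, all competing centers `ε a` are within `r z` of `ε z`;
  -- their values lie in one ball about `τ z`, which is convex.
  obtain ⟨_, ⟨z, hz, rfl⟩, hzS⟩ := exists_lt_of_lt_csSup
    (⟨_, a₀, ha₀, rfl⟩ : S.Nonempty) (half_lt_self hpos)
  have h1 : dist (m : M) (ε z) < r z / 8 := hz
  refine hball z (mk_mem_prod ?_ (convexHull_min ?_ (convex_ball _ _) (hF m)))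
  · have := hr z
    exact h1.trans (by linarith)
  · rintro _ ⟨a, ha, rfl⟩
    have h2 : dist (m : M) (ε a) < r a / 8 := ha
    have h3 : r a ≤ sSup S := le_csSup hbdd ⟨a, ha, rfl⟩
    have h4 := dist_triangle_left (ε a) (ε z) (m : M)
    have := hr z
    exact hτball z a (by linarith)

/-- A compact subset of `ℝ^N` has finite covering dimension. -/
theorem coveringDimLE_of_isCompact {N M : ℕ} (hM : 2 ^ N ≤ M) {P : Set (Fin N → ℝ)}
    (hP : IsCompact P) : CoveringDimLE P M := by
  classical
  intro 𝒰 ho hc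
  have : CompactSpace P := isCompact_iff_compactSpace.1 hP
  obtain ⟨δ, hδ, hδ𝒰⟩ := lebesgue_number_lemma_of_metric_sUnion (s := (univ : Set P))
    isCompact_univ ho hc.ge
  set η : ℝ := δ / 2 with hη
  have hη0 : 0 < η := by positivity
  -- Open cubes of side `2 * η = δ` centered at the lattice `η ℤ^N`. In each coordinate only two
  -- centers are possible, hence the crude bound `2 ^ N`.
  let C : (Fin N → ℤ) → Set P := fun k => {x | ∀ i, |(x : Fin N → ℝ) i - η * k i| < η}
  have hCo : ∀ k, IsOpen (C k) := by
    intro k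
    have : C k = ⋂ i, {x : P | |(x : Fin N → ℝ) i - η * k i| < η} := by ext; simp [C]
    rw [this]
    exact isOpen_iInter_of_finite fun i => isOpen_lt
      (((continuous_apply i).comp continuous_subtype_val).sub continuous_const).abs continuous_const
  refine ⟨{B | (∃ k, C k = B) ∧ B.Nonempty}, ?_, eq_univ_of_forall fun x => ?_, ?_, fun x => ?_⟩
  · rintro _ ⟨⟨k, rfl⟩, -⟩; exact hCo k
  · have hx : x ∈ C fun i => ⌊(x : Fin N → ℝ) i / η⌋ := by
      intro i
      have h1 := Int.floor_le ((x : Fin N → ℝ) i / η)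
      have h2 := Int.lt_floor_add_one ((x : Fin N → ℝ) i / η)
      rw [le_div_iff₀ hη0] at h1
      rw [div_lt_iff₀ hη0] at h2
      rw [abs_lt]
      constructor <;> nlinarith
    exact ⟨_, ⟨⟨_, rfl⟩, x, hx⟩, hx⟩
  · rintro _ ⟨⟨k, rfl⟩, x, hx⟩
    obtain ⟨A, hA, hxA⟩ := hδ𝒰 x (mem_univ x)
    refine ⟨A, hA, fun y hy => hxA ?_⟩
    rw [Metric.mem_ball, Subtype.dist_eq, dist_pi_lt_iff hδ]
    intro i
    have h1 := abs_lt.1 (hx i)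
    have h2 := abs_lt.1 (hy i)
    rw [Real.dist_eq, abs_lt]
    constructor <;> linarith
  · let I : Finset (Fin N → ℤ) := Fintype.piFinset fun i =>
      {⌊(x : Fin N → ℝ) i / η⌋, ⌊(x : Fin N → ℝ) i / η⌋ + 1}
    have hI : I.card ≤ 2 ^ N := by
      rw [Fintype.card_piFinset]
      calc _ ≤ ∏ _i : Fin N, 2 := Finset.prod_le_prod' fun i _ => Finset.card_le_two
        _ = 2 ^ N := by simp
    have hsub : {B ∈ {B | (∃ k, C k = B) ∧ B.Nonempty} | x ∈ B} ⊆ (I.image C : Finset (Set P)) := by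
      rintro _ ⟨⟨⟨k, rfl⟩, -⟩, hx⟩
      refine Finset.mem_coe.2 (Finset.mem_image_of_mem _ (Fintype.mem_piFinset.2 fun i => ?_))
      have h1 := abs_lt.1 (hx i)
      have h2 : (x : Fin N → ℝ) i / η < k i + 1 := by rw [div_lt_iff₀ hη0]; nlinarith
      have h3 : (k i : ℝ) - 1 < (x : Fin N → ℝ) i / η := by rw [lt_div_iff₀ hη0]; nlinarith
      have h4 : ⌊(x : Fin N → ℝ) i / η⌋ < k i + 1 := by
        rw [Int.floor_lt]; push_cast; exact h2
      have h5 : k i - 1 ≤ ⌊(x : Fin N → ℝ) i / η⌋ := by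
        rw [Int.le_floor]; push_cast; exact h3.le
      simp only [Finset.mem_insert, Finset.mem_singleton]
      omega
    refine (encard_le_encard hsub).trans ?_
    rw [encard_coe_eq_coe_finsetCard]
    have : (I.image C).card ≤ M + 1 := Finset.card_image_le.trans (by omega)
    exact_mod_cast this

/-- Truncation of real sequences approximates the identity uniformly on compact sets. -/
theorem exists_truncation_mem {K : Type*} [TopologicalSpace K] [CompactSpace K]
    {e : K → ℕ → ℝ} (he : Continuous e) {D : Set (K × (ℕ → ℝ))} (hD : IsOpen D)
    (heD : ∀ k, (k, e k) ∈ D) :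
    ∃ N : ℕ, ∀ k, (k, fun i => if i < N then e k i else 0) ∈ D := by
  have h : ∀ᶠ N : ℕ in Filter.atTop, ∀ k ∈ (univ : Set K),
      (k, fun i => if i < N then e k i else 0) ∈ D := by
    refine isCompact_univ.induction_on (p := fun s => ∀ᶠ N : ℕ in Filter.atTop, ∀ k ∈ s,
      (k, fun i => if i < N then e k i else 0) ∈ D) (by simp)
      (fun s t hst ht => ht.mono fun N hN k hk => hN k (hst hk))
      (fun s t hs ht => ?_) (fun k₀ _ => ?_)
    · filter_upwards [hs, ht] with N hs ht k hk
      exact hk.elim (hs k) (ht k)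
    · have hlim : Filter.Tendsto (fun p : ℕ × K =>
          (p.2, fun i => if i < p.1 then e p.2 i else 0)) (Filter.atTop ×ˢ 𝓝 k₀)
          (𝓝 (k₀, e k₀)) := by
        refine Filter.Tendsto.prodMk_nhds Filter.tendsto_snd (tendsto_pi_nhds.2 fun i => ?_)
        have h1 : Filter.Tendsto (fun p : ℕ × K => e p.2 i) (Filter.atTop ×ˢ 𝓝 k₀)
            (𝓝 (e k₀ i)) :=
          ((continuous_apply i).comp he).continuousAt.tendsto.comp Filter.tendsto_snd
        refine h1.congr' ?_
        filter_upwards [Filter.tendsto_fst.eventually (Filter.eventually_gt_atTop i)] with p hp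
        rw [if_pos hp]
      obtain ⟨p, hp, q, hq, hpq⟩ := Filter.eventually_prod_iff.1
        (hlim.eventually (hD.mem_nhds (heD k₀)))
      rw [nhdsWithin_univ]
      exact ⟨{k | q k}, hq, hp.mono fun N hN k hk => hpq hN hk⟩
  obtain ⟨N, hN⟩ := h.exists
  exact ⟨N, fun k => hN k (mem_univ k)⟩

/-! ### The two approximation theorems -/

/-- The composition of a multivalued map with a map to its source. -/
def MultivaluedMap.precomp {X : Type u} {Y : Type v} {P : Type w} (F : MultivaluedMap X Y)
    (ρ : P → X) : MultivaluedMap P Y where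
  toFun p := F (ρ p)
  nonempty_apply p := F.nonempty_apply (ρ p)

theorem MultivaluedMap.IsCompactMap.precomp {X : Type u} {Y : Type v} {P : Type w}
    [TopologicalSpace X] [TopologicalSpace Y] [TopologicalSpace P] {F : MultivaluedMap X Y}
    (hF : F.IsCompactMap) {ρ : P → X} (hρ : Continuous ρ) : (F.precomp ρ).IsCompactMap where
  upperSemicontinuous U hU := (hF.upperSemicontinuous U hU).preimage hρ
  isCompact_apply p := hF.isCompact_apply (ρ p)

/-- Approximation by single-valued maps over spaces of finite covering dimension. -/
theorem exists_approximation_of_coveringDimLE {X : Type u} [MetricSpace X] {Y : Type v}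
    [NormedAddCommGroup Y] [NormedSpace ℝ Y] {n : ℕ} {H : MultivaluedMap X Y}
    (ℋ : SingularFiltration.{u, v, w} H n) (hdim : CoveringDimLE X n)
    (hc : ℋ.IsCompactFiltration) (hA : ℋ.IsApproxConnected) {U : Set (X × Y)}
    (hU : U ∈ 𝓝ˢ H.graph) : ∃ h : C(X, Y), ∀ x : X, (x, h x) ∈ U := by
  obtain ⟨e, K, T, he, hK, hT, hne, hcpt, husc, hTK, hTA, -⟩ := ℋ.exists_realSequences_model hc hA
  have hUi : H.graph ⊆ interior U := subset_interior_iff_mem_nhdsSet.2 hU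
  obtain ⟨W, hW, hεW, F, hF⟩ := exists_approximate_neighborhood_extension
    ((hc (Fin.last n)).isClosedEmbedding_graph he).isInducing
    (τ := fun p => (ℋ.transLast.toMap p : X × Y).2) (by fun_prop)
    (𝒢 := {p | (p.1.1, p.2) ∈ interior U}) (isOpen_interior.preimage (by fun_prop))
    (fun p => hUi (by
      rw [← ℋ.transLast.fst_eq p]
      exact (ℋ.transLast.toMap p).2))
  obtain ⟨g, hg⟩ := exists_graph_approximation hdim hT hne hcpt husc hTK hTA hW (by
    intro x q hq
    rw [hK n le_rfl] at hq
    obtain ⟨y, hy, rfl⟩ := hq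
    exact hεW ⟨⟨(x, y), hy⟩, rfl⟩)
  exact ⟨⟨fun x => F ⟨(x, g x), hg x⟩, by fun_prop⟩, fun x => interior_subset (hF ⟨(x, g x), hg x⟩)⟩

/-- Approximation by single-valued maps over compact subsets of an ANR. -/
theorem exists_approximation_of_isApproxInftyConnected {X : Type u} [TopologicalSpace X]
    {Y : Type v} [TopologicalSpace Y] (hX : IsANR X) (hY : IsANR Y) {F : MultivaluedMap X Y}
    {n : ℕ} (ℱ : SingularFiltration.{u, v, w} F n) (hF : F.IsCompactMap)
    (hc : ℱ.IsCompactFiltration) (hA : ℱ.IsApproxInftyConnected) {K : Set X} (hK : IsCompact K)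
    {U : Set (X × Y)} (hU : U ∈ 𝓝ˢ (F.graphOn K)) :
    ∃ f : C(K, Y), ∀ x : K, ((x : X), f x) ∈ U := by
  have := hX.metrizable
  have := hX.separable
  have := hY.metrizable
  have : CompactSpace K := isCompact_iff_compactSpace.1 hK
  have hUi : F.graphOn K ⊆ interior U := subset_interior_iff_mem_nhdsSet.2 hU
  obtain ⟨eX, heX⟩ := exists_isEmbedding_realSequences X
  let e : K → ℕ → ℝ := fun k => eX k
  have he : IsEmbedding e := heX.comp IsEmbedding.subtypeVal
  obtain ⟨O, hO, heO, r, hr⟩ := hX.exists_neighborhood_extension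
    (he.continuous.isClosedEmbedding he.injective) (⟨Subtype.val, continuous_subtype_val⟩ : C(K, X))
  have hclose : IsOpen {p : X × X | ∀ y ∈ F p.2, (p.1, y) ∈ interior U} := by
    rw [isOpen_iff_mem_nhds]
    rintro ⟨x, x'⟩ hx
    obtain ⟨S, V, hS, hV, hxS, hxV, hSV⟩ := generalized_tube_lemma (isCompact_singleton (x := x))
      (hF.isCompact_apply x') (isOpen_interior (s := U)) (by
        rintro ⟨z, y⟩ ⟨hz, hy⟩
        have hz' : z = x := hz
        subst hz'
        exact hx y hy)
    filter_upwards [prod_mem_nhds (hS.mem_nhds (hxS rfl))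
      ((hF.upperSemicontinuous V hV).mem_nhds hxV)]
    rintro ⟨z, z'⟩ ⟨hz, hz'⟩ y hy
    exact hSV (mk_mem_prod hz (hz' hy))
  -- `N` is so large that the truncation of `e k` lies in `O` and the fiber of `F` over its image
  -- under `r` still forms points of `interior U` with `k`.
  obtain ⟨N, hN⟩ := exists_truncation_mem he.continuous
    (D := Subtype.val '' {p : (Prod.snd ⁻¹' O : Set (K × (ℕ → ℝ))) |
      ∀ y ∈ F (r ⟨p.1.2, p.2⟩), ((p.1.1 : X), y) ∈ interior U})
    ((hO.preimage continuous_snd).isOpenMap_subtype_val _ (hclose.preimage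
      (f := fun p : (Prod.snd ⁻¹' O : Set (K × (ℕ → ℝ))) => ((p.1.1 : X), r ⟨p.1.2, p.2⟩))
      (by fun_prop)))
    (fun k => ⟨⟨(k, e k), heO ⟨k, rfl⟩⟩, fun y hy => hUi ⟨k.2, by
      simpa [hr k (heO ⟨k, rfl⟩)] using hy⟩, rfl⟩)
  let π : K → Fin N → ℝ := fun k i => e k i
  have hπ : Continuous π := continuous_pi fun i => (continuous_apply _).comp he.continuous
  let j : (Fin N → ℝ) → ℕ → ℝ := fun s i => if h : i < N then s ⟨i, h⟩ else 0
  have hj : Continuous j := continuous_pi fun i => by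
    by_cases h : i < N
    · simp only [j, dif_pos h]; fun_prop
    · simp only [j, dif_neg h]; fun_prop
  have hjπ : ∀ k, j (π k) = fun i => if i < N then e k i else 0 := fun k => by
    funext i
    by_cases h : i < N <;> simp [j, π, h]
  have hN' : ∀ k, ∃ h : j (π k) ∈ O, ∀ y ∈ F (r ⟨j (π k), h⟩), ((k : X), y) ∈ interior U := by
    intro k
    obtain ⟨⟨⟨k', q⟩, hq⟩, hp, heq⟩ := hN k
    simp only [Prod.mk.injEq] at heq
    obtain ⟨rfl, rfl⟩ := heq
    rw [hjπ]
    exact ⟨hq, hp⟩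
  let P : Set (Fin N → ℝ) := range π
  have hjP : ∀ s : P, j s ∈ O := by
    rintro ⟨_, k, rfl⟩
    exact (hN' k).1
  let ρ : P → X := fun s => r ⟨j s, hjP s⟩
  have hρ : Continuous ρ := by fun_prop
  let p : K → P := rangeFactorization π
  have hp : Continuous p := hπ.subtype_mk _
  -- Many `k` may share one truncation, and a value chosen on `P` must suit them all; openness holds
  -- because `p` is proper.
  have h𝒢 : IsOpen {z : P × Y | ∀ k, p k = z.1 → ((k : X), z.2) ∈ interior U} := by
    have hcl : IsClosedMap (Prod.map p (id : Y → Y)) :=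
      (hp.isProperMap.prodMap isProperMap_id).isClosedMap
    have := (hcl _ ((isOpen_interior (s := U)).preimage
      (f := fun z : K × Y => ((z.1 : X), z.2)) (by fun_prop)).isClosed_compl).isOpen_compl
    convert this using 1
    ext ⟨s, y⟩
    simp only [mem_ofPred_eq, mem_compl_iff, mem_image, Prod.exists, Prod.map_apply, id,
      Prod.mk.injEq, mem_preimage, not_exists, not_and]
    constructor
    · rintro h k y' hk hs rfl
      exact hk (h k hs)
    · intro h k hs
      by_contra hk
      exact h k y hk hs rfl
  obtain ⟨eL, H, T, heL, hHL, hT, hne, hcpt, husc, hTH, hTA, hTA'⟩ :=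
    ℱ.exists_realSequences_model hc hA.1
  obtain ⟨O', hO', hO'r, Θ, hΘ⟩ := hY.exists_neighborhood_extension
    (((hc (Fin.last n)).precomp hρ).isClosedEmbedding_graph heL)
    ⟨fun z => (ℱ.transLast.toMap ⟨(ρ z.1.1, z.1.2), z.2⟩ : X × Y).2, by fun_prop⟩
  -- `2 ^ N` bounds the dimension of `P`; adding `n` ensures that the last member is the frozen
  -- `n`-th one.
  obtain ⟨g, hg⟩ := exists_graph_approximation (X := P) (n := 2 ^ N + n)
    (H := fun i s => H i (ρ s)) (T := fun i z => T i (ρ z.1, z.2))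
    (coveringDimLE_of_isCompact (Nat.le_add_right _ _) (isCompact_range hπ))
    (fun i => (hT i).comp (by fun_prop)) (fun i s => hne i _) (fun i s => hcpt i _)
    (fun i V hV => (husc i V hV).preimage hρ) (fun i s => hTH i _)
    (fun i _ s => (Nat.lt_or_ge i n).elim (fun hi => hTA i hi _) (fun hi => hTA' hA.2 i hi _))
    (W := Subtype.val '' {z : O' | (z.1.1, Θ z) ∈
      {z : P × Y | ∀ k, p k = z.1 → ((k : X), z.2) ∈ interior U}})
    (hO'.isOpenMap_subtype_val _ (h𝒢.preimage (by fun_prop))) (by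
      intro s q hq
      simp only [hHL _ (Nat.le_add_left n _)] at hq
      obtain ⟨y, hy, rfl⟩ := hq
      refine ⟨⟨(s, eL y), hO'r ⟨⟨(s, y), hy⟩, rfl⟩⟩, ?_, rfl⟩
      rintro k rfl
      have h1 := hΘ ⟨(p k, y), hy⟩ (hO'r ⟨⟨(p k, y), hy⟩, rfl⟩)
      refine (hN' k).2 _ ?_
      simp only at h1 ⊢
      rw [h1]
      exact ℱ.transLast.snd_mem ⟨(ρ (p k), y), hy⟩)
  have hgO : ∀ s, (s, g s) ∈ O' := fun s => by
    obtain ⟨z, -, hz⟩ := hg s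
    exact hz ▸ z.2
  refine ⟨⟨fun k => Θ ⟨(p k, g (p k)), hgO _⟩, by fun_prop⟩, fun k => interior_subset ?_⟩
  obtain ⟨⟨z, hzO⟩, hz, hzeq⟩ := hg (p k)
  simp only at hzeq
  subst hzeq
  exact hz k rfl
theorem mainTheorem6 :
    (∀ (X : Type u) [MetricSpace X] (Y : Type v) [NormedAddCommGroup Y] [NormedSpace ℝ Y]
        [CompleteSpace Y] (n : ℕ) (H : MultivaluedMap X Y)
        (ℋ : SingularFiltration.{u, v, w} H n),
        CoveringDimLE X n → ℋ.IsCompactFiltration → ℋ.IsApproxConnected →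
        ∀ U ∈ 𝓝ˢ H.graph, ∃ h : C(X, Y), ∀ x : X, (x, h x) ∈ U) ∧
    (∀ (X : Type u) [TopologicalSpace X] (Y : Type v) [TopologicalSpace Y],
        IsANR X → IsANR Y →
        ∀ (F : MultivaluedMap X Y) (n : ℕ) (ℱ : SingularFiltration.{u, v, w} F n),
        F.IsCompactMap → ℱ.IsCompactFiltration → ℱ.IsApproxInftyConnected →
        ∀ K : Set X, IsCompact K →
        ∀ U ∈ 𝓝ˢ (F.graphOn K), ∃ f : C(K, Y), ∀ x : K, ((x : X), f x) ∈ U) := by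
  exact ⟨fun X _ Y _ _ _ n H ℋ hdim hc hA U hU =>
      exists_approximation_of_coveringDimLE ℋ hdim hc hA hU,
    fun X _ Y _ hX hY F n ℱ hF hc hA K hK U hU =>
      exists_approximation_of_isApproxInftyConnected hX hY ℱ hF hc hA hK hU⟩
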